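/- Let $n\ge 1$, $\lambda_e,\lambda_s>0$ and $\lambda_g\ge 0$. Consider a network of a source and $n$ nodes, where $\nu_s(t)$ and $\nu_i(t)$ are the versions of the information held at time $t$ by the source and by node $i$; node $i$ is called fresh at time $t$ if $\nu_i(t)=\nu_s(t)$ and stale otherwise. The versions $(\nu_s,\nu_1,\dots,\nu_n)$ form a continuous-time Markov chain, started from any deterministic versions with $\nu_i(0)\le\nu_s(0)$ for all $i$, with the following transitions (fully connected network with RC-Gossip at the source and at the gossiping nodes): - the source updates itself, $\nu_s\mapsto\nu_s+1$, at rate $\lambda_e$; - when exactly $k<n$ nodes are fresh, each stale node $i$ receives an update from the source, $\nu_i\mapsto\nu_s$, at rate $\lambda_s/(n-k)$, and from each fresh node $j$ a gossip update, $\nu_i\mapsto\nu_j$, at rate $\lambda_g/(n-k)$; - nothing is sent to fresh nodes, and stale nodes do not gossip. Let $F_i(t)=\mathbb{I}_{\{\nu_i(t)=\nu_s(t)\}}$ be the binary freshness of node $i$. Then, for every node $i$, $F_i$ is integrable on $(0,T]\times\Omega$ for every $T>0$, where $\Omega$ is the underlying probability space, and the long-term average freshness of node $i$ is $$\overline F_i:=\limsup_{T\to\infty}\frac1T\,\mathbb{E}\left[\int_0^T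 F_i(t)\,dt\right]=\frac1n\sum_{k=1}^{n}\prod_{j=1}^{k}\frac{\lambda_s+(j-1)\lambda_g}{\lambda_s+(j-1)\lambda_g+\lambda_e}.$$ -/

import Mathlib

open MeasureTheory ProbabilityTheory Filter Topology
open scoped ENNReal

noncomputable section

/-- Versions of the information held in a network of one source and `n` nodes: `src` is the
version `ν_s` of the source and `node i` the version `ν_i` of node `i`. -/
structure NetState (n : ℕ) where
  src : ℕ
  node : Fin n → ℕ

/-- The possible events: the source updates itself, the source sends its information to node `i`,
node `j` gossips its information to node `i`. -/
inductive Clock (n : ℕ) where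
  | selfUpdate : Clock n
  | source (i : Fin n) : Clock n
  | gossip (j i : Fin n) : Clock n

namespace NetState

variable {n : ℕ}

/-- Node `i` is fresh when it holds the version of the source. -/
def IsFresh (x : NetState n) (i : Fin n) : Prop := x.node i = x.src

instance (x : NetState n) (i : Fin n) : Decidable (x.IsFresh i) :=
  inferInstanceAs (Decidable (x.node i = x.src))

/-- The number of fresh nodes. -/
def numFresh (x : NetState n) : ℕ := (Finset.univ.filter fun i => x.IsFresh i).card

/-- The effect of an event on the versions. -/
def apply (x : NetState n) : Clock n → NetState n
  | .selfUpdate => ⟨x.src + 1, x.node⟩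
  | .source i => ⟨x.src, Function.update x.node i x.src⟩
  | .gossip j i => ⟨x.src, Function.update x.node i (x.node j)⟩

/-- The current rate of each event in the fully connected network with RC-Gossip at the source and
at the nodes. The source updates itself at rate `le`. When `k` nodes are fresh, each of the `n - k`
stale nodes receives updates from the source at rate `ls / (n - k)`, and gossip from each of the
fresh nodes at rate `lg / (n - k)`. Nothing is sent to fresh nodes. -/
def rate (le ls lg : ℝ) (x : NetState n) : Clock n → ℝ
  | .selfUpdate => le
  | .source i => if x.IsFresh i then 0 else ls / ((n : ℝ) - (x.numFresh : ℝ))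
  | .gossip j i =>
      if x.IsFresh j ∧ ¬ x.IsFresh i then lg / ((n : ℝ) - (x.numFresh : ℝ)) else 0

end NetState

namespace RCGossip

variable {n : ℕ}

/-- The waiting time of clock `c` in state `x`, when `e c` is its standard exponential variable:
an exponential time with the current rate of `c` (and `∞` when that rate is zero). -/
def ringTime (le ls lg : ℝ) (x : NetState n) (e : Clock n → ℝ) (c : Clock n) : ℝ≥0∞ :=
  ENNReal.ofReal (e c) / ENNReal.ofReal (x.rate le ls lg c)

open Classical in
/-- The clock that rings strictly before all the others (the convention for ties, which have
probability zero, is immaterial). -/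
def firstClock (le ls lg : ℝ) (x : NetState n) (e : Clock n → ℝ) : Clock n :=
  if h : ∃ c, ∀ c', c' ≠ c → ringTime le ls lg x e c < ringTime le ls lg x e c' then h.choose
  else .selfUpdate

/-- The network after `m` events, started from the versions `x₀`; `ξ m c` is the standard
exponential variable used by clock `c` between the `m`-th and the `(m + 1)`-st event. -/
def jumpChain (le ls lg : ℝ) (x₀ : NetState n) (ξ : ℕ → Clock n → ℝ) : ℕ → NetState n
  | 0 => x₀
  | m + 1 =>
      (jumpChain le ls lg x₀ ξ m).apply
        (firstClock le ls lg (jumpChain le ls lg x₀ ξ m) (ξ m))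

/-- The time of the `m`-th event (with time `0` for `m = 0`). -/
def jumpTime (le ls lg : ℝ) (x₀ : NetState n) (ξ : ℕ → Clock n → ℝ) : ℕ → ℝ≥0∞
  | 0 => 0
  | m + 1 =>
      jumpTime le ls lg x₀ ξ m + ⨅ c, ringTime le ls lg (jumpChain le ls lg x₀ ξ m) (ξ m) c

/-- The number of events in `(0, t]` (almost surely finite, since the rates are bounded). -/
def numEvents (le ls lg : ℝ) (x₀ : NetState n) (ξ : ℕ → Clock n → ℝ) (t : ℝ) : ℕ :=
  Set.ncard {m : ℕ | jumpTime le ls lg x₀ ξ (m + 1) ≤ ENNReal.ofReal t}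

/-- The versions in the network at time `t`: the continuous-time Markov chain with the transition
rates `NetState.rate`, in its construction by competing exponential clocks. -/
def state (le ls lg : ℝ) (x₀ : NetState n) (ξ : ℕ → Clock n → ℝ) (t : ℝ) : NetState n :=
  jumpChain le ls lg x₀ ξ (numEvents le ls lg x₀ ξ t)

/-- The binary freshness `F_i(t)` of node `i` at time `t`. -/
def freshness (le ls lg : ℝ) (x₀ : NetState n) (ξ : ℕ → Clock n → ℝ) (i : Fin n) (t : ℝ) : ℝ :=
  if (state le ls lg x₀ ξ t).IsFresh i then 1 else 0

/-- The long-term average freshness of node `i`,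
`limsup_{T → ∞} (1 / T) 𝔼 [∫₀ᵀ F_i(t) dt]`. -/
def averageFreshness {Ω : Type*} [MeasurableSpace Ω] (P : Measure Ω) (le ls lg : ℝ)
    (x₀ : NetState n) (ξ : ℕ → Clock n → Ω → ℝ) (i : Fin n) : ℝ :=
  limsup (fun T : ℝ =>
    (1 / T) * ∫ ω, (∫ t in (0 : ℝ)..T, freshness le ls lg x₀ (fun m c => ξ m c ω) i t) ∂P) atTop

end RCGossip

end

noncomputable section

/-! ### Competing exponential clocks -/

namespace CompetingClocks

/-! An update of the source makes every node stale. Until the next one, while `k < n` nodes are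
fresh, some stale node is refreshed at total rate `a_k = ls + k * lg`, in competition with the
source's rate `le`. The `m`-th refresh of a cycle therefore occurs with probability `∏ j < m, a_j /
(a_j + le)`, and the mean number of refreshes in a cycle is `refreshCount le ls lg n 0`. By symmetry
node `i` is refreshed with `1 / n` of this as probability; it then stays fresh for a mean time `1 /
le`, which is also the mean length of a cycle. This gives the long-term fraction `a = refreshCount
le ls lg n 0 / n`.

The proof replaces renewal theory by a Poisson equation: the bounded function `freshPotential` has
generator `a` minus the indicator of freshness (`generator_freshPotential`). Dynkin's formula then
bounds the distance of the expected fresh time up to `T` from `a * T` by twice the bound of the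
potential, and division by `T` ends the proof.

Dynkin's formula is obtained one event at a time. `integral_firstClock` computes the joint effect of
the winner of a race of exponential clocks and of its time; `integral_event` transfers this to the
chain by independence. Summed over the first `m` events, the increments of the potential telescope
(`exists_sum_telescope`) and the generator terms form a time integral. Letting `m` tend to infinity
is justified by `mul_measure_jumpTime_lt_le`, which makes `m` events before `T` unlikely. -/

instance isProbabilityMeasure_expMeasure_one : IsProbabilityMeasure (expMeasure 1) :=
  isProbabilityMeasure_expMeasure one_pos

variable {ι : Type*}

/-- The waiting time of clock `c` with rate `r c`. -/
def ring (r : ι → ℝ) (e : ι → ℝ) (c : ι) : ℝ≥0∞ := ENNReal.ofReal (e c) / ENNReal.ofReal (r c)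

/-- The first waiting time. -/
def firstRing (r : ι → ℝ) (e : ι → ℝ) : ℝ≥0∞ := ⨅ c, ring r e c

lemma measurable_ring (r : ι → ℝ) (c : ι) : Measurable fun e => ring r e c := by
  unfold ring; fun_prop

/-- Rate zero needs no exception: in `ℝ≥0∞`, division by zero gives `∞` for a positive numerator and
`0` for a zero one. -/
lemma ofReal_lt_ring_iff {r : ι → ℝ} {c : ι} (hr : 0 ≤ r c) {t : ℝ} (ht : 0 ≤ t) (e : ι → ℝ) :
    ENNReal.ofReal t < ring r e c ↔ t * r c < e c := by
  rcases hr.eq_or_lt with h | h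
  · rw [ring, ← h]
    rcases le_or_gt (e c) 0 with he | he
    · simp [ENNReal.ofReal_of_nonpos he, he]
    · simp [ENNReal.div_zero, he]
  · rw [ring, ENNReal.lt_div_iff_mul_lt (by simp [h]) (by simp), ← ENNReal.ofReal_mul ht]
    exact ENNReal.ofReal_lt_ofReal_iff_of_nonneg (by positivity)

/-- The first waiting time truncated at `s`. -/
def truncRing (r : ι → ℝ) (s : ℝ≥0∞) (e : ι → ℝ) : ℝ := (min (firstRing r e) s).toReal

lemma truncRing_nonneg (r : ι → ℝ) (s : ℝ≥0∞) (e : ι → ℝ) : 0 ≤ truncRing r s e :=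
  ENNReal.toReal_nonneg

lemma truncRing_le (r : ι → ℝ) {s : ℝ≥0∞} (hs : s ≠ ∞) (e : ι → ℝ) :
    truncRing r s e ≤ s.toReal :=
  ENNReal.toReal_mono hs (min_le_right _ _)

/-- Clock `c` rings strictly before all others and before time `s`. -/
def winSet (r : ι → ℝ) (s : ℝ≥0∞) (c : ι) : Set (ι → ℝ) :=
  {e | ring r e c < s ∧ ∀ c', c' ≠ c → ring r e c < ring r e c'}

lemma firstRing_eq_of_mem_winSet {r : ι → ℝ} {s : ℝ≥0∞} {c : ι} {e : ι → ℝ}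
    (he : e ∈ winSet r s c) : firstRing r e = ring r e c :=
  le_antisymm (iInf_le _ c) <| le_iInf fun c' => by
    by_cases h : c' = c
    · rw [h]
    · exact (he.2 c' h).le

lemma disjoint_winSet (r : ι → ℝ) (s : ℝ≥0∞) {c c' : ι} (h : c ≠ c') :
    Disjoint (winSet r s c) (winSet r s c') :=
  Set.disjoint_left.2 fun _ h1 h2 => lt_asymm (h1.2 c' h.symm) (h2.2 c h)

variable [Fintype ι]

/-- The law of a family of independent standard exponential variables. -/
def clockMeasure (ι : Type*) [Fintype ι] : Measure (ι → ℝ) := Measure.pi fun _ => expMeasure 1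

instance : IsProbabilityMeasure (clockMeasure ι) := by unfold clockMeasure; infer_instance

lemma measurable_firstRing (r : ι → ℝ) : Measurable (firstRing r) :=
  Measurable.iInf fun c => measurable_ring r c

lemma measurable_truncRing (r : ι → ℝ) (s : ℝ≥0∞) : Measurable (truncRing r s) :=
  ((measurable_firstRing r).min measurable_const).ennreal_toReal

lemma measurableSet_winSet (r : ι → ℝ) (s : ℝ≥0∞) (c : ι) : MeasurableSet (winSet r s c) := by
  simp only [winSet, Set.ofPred_and, Set.ofPred_forall]
  exact (measurableSet_lt (measurable_ring r c) measurable_const).inter <|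
    MeasurableSet.iInter fun c' => MeasurableSet.iInter fun _ =>
      measurableSet_lt (measurable_ring r c) (measurable_ring r c')

/-! ### Exponential tails and the law of the first ring. -/

lemma expMeasure_Iic {x : ℝ} : expMeasure 1 (Set.Iic x)
    = ENNReal.ofReal (if 0 ≤ x then 1 - Real.exp (-x) else 0) := by
  have := lintegral_exponentialPDF_eq_antiDeriv (r := 1) one_pos x
  rw [one_mul] at this
  rw [← this, expMeasure, gammaMeasure, withDensity_apply _ measurableSet_Iic]
  rfl

lemma expMeasure_Ioi {x : ℝ} (hx : 0 ≤ x) :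
    expMeasure 1 (Set.Ioi x) = ENNReal.ofReal (Real.exp (-x)) := by
  rw [← Set.compl_Iic, prob_compl_eq_one_sub measurableSet_Iic, expMeasure_Iic, if_pos hx,
    ← ENNReal.ofReal_one, ← ENNReal.ofReal_sub _ (by simp [hx])]
  simp

lemma setLIntegral_eq_of_subset {α : Type*} [MeasurableSpace α] {μ : Measure α} {s t : Set α}
    {f : α → ℝ≥0∞} (hs : MeasurableSet s) (ht : MeasurableSet t) (hst : s ⊆ t)
    (hf : ∀ x ∈ t \ s, f x = 0) : ∫⁻ x in t, f x ∂μ = ∫⁻ x in s, f x ∂μ := by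
  rw [← lintegral_inter_add_sdiff f t hs, Set.inter_eq_self_of_subset_right hst,
    setLIntegral_eq_zero (ht.diff hs) hf, add_zero]

lemma lintegral_Ioo_exp {q s : ℝ} (hq : 0 < q) (hs : 0 ≤ s) :
    ∫⁻ t in Set.Ioo 0 s, ENNReal.ofReal (Real.exp (-(q * t)))
      = ENNReal.ofReal ((1 - Real.exp (-(q * s))) / q) := by
  have h1 : ∫⁻ t in Set.Ioo 0 s, exponentialPDF q t = ∫⁻ t in Set.Iic s, exponentialPDF q t := by
    rw [setLIntegral_eq_of_subset (s := Set.Icc 0 s) measurableSet_Icc measurableSet_Iic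
      (fun x hx => hx.2) (fun x hx => exponentialPDF_of_neg (by
        by_contra h; exact hx.2 ⟨not_lt.1 h, hx.1⟩))]
    exact setLIntegral_congr Ioo_ae_eq_Icc
  rw [lintegral_exponentialPDF_eq_antiDeriv hq, if_pos hs] at h1
  have h2 : ∫⁻ t in Set.Ioo 0 s, ENNReal.ofReal (Real.exp (-(q * t)))
      = ∫⁻ t in Set.Ioo 0 s, ENNReal.ofReal q⁻¹ * exponentialPDF q t := by
    refine setLIntegral_congr_fun measurableSet_Ioo fun t ht => ?_
    rw [exponentialPDF_of_nonneg ht.1.le, ← ENNReal.ofReal_mul (by positivity)]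
    congr 1
    field_simp
  rw [h2, lintegral_const_mul' _ _ (by simp), h1, ← ENNReal.ofReal_mul (by positivity)]
  congr 1
  field_simp

lemma clockMeasure_forall_lt_ring {r : ι → ℝ} (hr : ∀ c, 0 ≤ r c) (S : Finset ι) {t : ℝ}
    (ht : 0 ≤ t) : clockMeasure ι {e | ∀ c ∈ S, ENNReal.ofReal t < ring r e c}
      = ENNReal.ofReal (Real.exp (-((∑ c ∈ S, r c) * t))) := by
  classical
  have : {e : ι → ℝ | ∀ c ∈ S, ENNReal.ofReal t < ring r e c}
      = Set.univ.pi fun c => if c ∈ S then Set.Ioi (t * r c) else Set.univ := by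
    ext e
    simp only [Set.mem_ofPred_eq, Set.mem_pi, Set.mem_univ, true_imp_iff,
      ofReal_lt_ring_iff (hr _) ht]
    refine forall_congr' fun c => ?_
    split_ifs with h <;> simp [h]
  rw [this, clockMeasure, Measure.pi_pi]
  have h2 : ∀ c, expMeasure 1 (if c ∈ S then Set.Ioi (t * r c) else Set.univ)
      = if c ∈ S then ENNReal.ofReal (Real.exp (-(t * r c))) else 1 := by
    intro c
    split_ifs
    · exact expMeasure_Ioi (mul_nonneg ht (hr c))
    · simp
  simp_rw [h2]
  rw [Finset.prod_ite_mem, Finset.univ_inter, ← ENNReal.ofReal_prod_of_nonneg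
    (fun _ _ => (Real.exp_pos _).le), ← Real.exp_sum, Finset.sum_neg_distrib, Finset.sum_mul]
  simp_rw [mul_comm t]

/-- Finiteness matters: the infimum is attained, so the strict inequality survives. -/
lemma lt_firstRing_iff [Nonempty ι] {r e : ι → ℝ} {t : ℝ≥0∞} :
    t < firstRing r e ↔ ∀ c, t < ring r e c := by
  refine ⟨fun h c => h.trans_le (iInf_le _ c), fun h => ?_⟩
  obtain ⟨c, hc⟩ := exists_eq_ciInf_of_finite (f := ring r e)
  rw [firstRing, ← hc]
  exact h c

lemma clockMeasure_lt_firstRing [Nonempty ι] {r : ι → ℝ} (hr : ∀ c, 0 ≤ r c) {t : ℝ}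
    (ht : 0 ≤ t) : clockMeasure ι {e | ENNReal.ofReal t < firstRing r e}
      = ENNReal.ofReal (Real.exp (-((∑ c, r c) * t))) := by
  rw [← clockMeasure_forall_lt_ring hr Finset.univ ht]
  simp [lt_firstRing_iff]

/-- Layer-cake formula: the tail of the truncated time is `exp (-(q * t))` for `t < s`, with `q` the
total rate, and zero afterwards. -/
lemma integral_truncRing [Nonempty ι] {r : ι → ℝ} (hr : ∀ c, 0 ≤ r c) (hq : 0 < ∑ c, r c)
    {s : ℝ} (hs : 0 ≤ s) : ∫ e, truncRing r (ENNReal.ofReal s) e ∂clockMeasure ι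
      = (1 - Real.exp (-((∑ c, r c) * s))) / ∑ c, r c := by
  rw [integral_eq_lintegral_of_nonneg_ae (ae_of_all _ fun e => truncRing_nonneg _ _ e)
    (measurable_truncRing _ _).aestronglyMeasurable,
    lintegral_eq_lintegral_meas_lt _ (ae_of_all _ fun e => truncRing_nonneg _ _ e)
    (measurable_truncRing _ _).aemeasurable]
  have key : ∫⁻ t in Set.Ioi 0, clockMeasure ι {e | t < truncRing r (ENNReal.ofReal s) e}
      = ∫⁻ t in Set.Ioo 0 s, ENNReal.ofReal (Real.exp (-((∑ c, r c) * t))) := by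
    rw [setLIntegral_eq_of_subset (s := Set.Ioo 0 s) measurableSet_Ioo measurableSet_Ioi
      (fun x hx => hx.1)]
    · refine setLIntegral_congr_fun measurableSet_Ioo fun t ht => ?_
      rw [← clockMeasure_lt_firstRing hr ht.1.le]
      congr 1
      ext e
      simp only [Set.mem_ofPred_eq, truncRing]
      rw [← ENNReal.ofReal_lt_iff_lt_toReal ht.1.le (by simp), lt_min_iff]
      simp [ENNReal.ofReal_lt_ofReal_iff_of_nonneg ht.1.le, ht.2]
    · intro t ht
      have : {e | t < truncRing r (ENNReal.ofReal s) e} = ∅ := by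
        ext e
        simp only [Set.mem_ofPred_eq, Set.mem_empty_iff_false, iff_false, not_lt]
        refine (truncRing_le r (by simp) e).trans ?_
        rw [ENNReal.toReal_ofReal hs]
        by_contra h
        exact ht.2 ⟨ht.1, not_le.1 h⟩
      rw [this, measure_empty]
  rw [key, lintegral_Ioo_exp hq hs, ENNReal.toReal_ofReal]
  refine div_nonneg (sub_nonneg.2 (Real.exp_le_one_iff.2 ?_)) hq.le
  have := mul_nonneg hq.le hs
  linarith

lemma ae_pos (c : ι) : ∀ᵐ e ∂clockMeasure ι, 0 < e c := by
  refine (measurePreserving_eval (fun _ : ι => expMeasure 1) c).quasiMeasurePreserving.ae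
    (p := fun x => 0 < x) ?_
  refine measure_mono_null (t := Set.Iic 0) (fun x hx => ?_) ?_
  · exact not_lt.1 fun h : 0 < x => hx h
  · simp [expMeasure_Iic]

/-- Condition on the variable of clock `c`, which is independent of all the others, and integrate
the probability that they ring later. -/
lemma clockMeasure_winSet_of_pos {r : ι → ℝ} (hr : ∀ c, 0 ≤ r c) {c : ι} (hc : 0 < r c) {s : ℝ}
    (hs : 0 ≤ s) : clockMeasure ι (winSet r (ENNReal.ofReal s) c)
      = ENNReal.ofReal (r c * ((1 - Real.exp (-((∑ c, r c) * s))) / ∑ c, r c)) := by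
  classical
  set q := ∑ c, r c with hqdef
  have hq : 0 < q := hc.trans_le (Finset.single_le_sum (fun c _ => hr c) (Finset.mem_univ c))
  let S := Finset.univ.erase c
  have hind : IndepFun (fun (e : ι → ℝ) (i : ({c} : Finset ι)) => e i)
      (fun (e : ι → ℝ) (i : S) => e i) (clockMeasure ι) :=
    (iIndepFun_pi (μ := fun _ : ι => expMeasure 1) (X := fun _ => id)
      (fun _ => aemeasurable_id)).indepFun_finset {c} S (by simp [S]) fun i => measurable_pi_apply i
  let B : Set ((({c} : Finset ι) → ℝ) × (S → ℝ)) := {p | ENNReal.ofReal (p.1 ⟨c, by simp⟩) /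
    ENNReal.ofReal (r c) < ENNReal.ofReal s ∧ ∀ c' : S, ENNReal.ofReal (p.1 ⟨c, by simp⟩) /
    ENNReal.ofReal (r c) < ENNReal.ofReal (p.2 c') / ENNReal.ofReal (r c')}
  have hB : MeasurableSet B := by
    simp only [B, Set.ofPred_and, Set.ofPred_forall]
    exact (measurableSet_lt (by fun_prop) (by fun_prop)).inter <|
      MeasurableSet.iInter fun c' => measurableSet_lt (by fun_prop) (by fun_prop)
  have hmX : Measurable fun (e : ι → ℝ) (i : ({c} : Finset ι)) => e i := by fun_prop
  have hmY : Measurable fun (e : ι → ℝ) (i : S) => e i := by fun_prop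
  have h1 : winSet r (ENNReal.ofReal s) c
      = (fun e : ι → ℝ => ((fun i : ({c} : Finset ι) => e i), fun i : S => e i)) ⁻¹' B := by
    ext e
    simp [winSet, B, ring, S]
  rw [h1, ← Measure.map_apply (hmX.prodMk hmY) hB,
    hind.map_prod_eq_prod_map_map hmX.aemeasurable hmY.aemeasurable, Measure.prod_apply hB,
    lintegral_map (measurable_measure_prodMk_left hB) hmX]
  have h2 : ∀ e : ι → ℝ, (Measure.map (fun (e : ι → ℝ) (i : S) => e i) (clockMeasure ι))
      (Prod.mk (fun i : ({c} : Finset ι) => e i) ⁻¹' B)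
      = (fun x : ℝ => if ENNReal.ofReal x / ENNReal.ofReal (r c) < ENNReal.ofReal s then
        clockMeasure ι {e' | ∀ c' ∈ S, ENNReal.ofReal x / ENNReal.ofReal (r c) < ring r e' c'}
        else 0) (e c) := by
    intro e
    rw [Measure.map_apply hmY (measurable_prodMk_left hB)]
    simp only
    split_ifs with h
    · congr 1
      ext e'
      simp [B, ring, h]
    · convert measure_empty (μ := clockMeasure ι)
      ext e'
      simp only [B, Set.mem_preimage, Set.mem_ofPred_eq, h, false_and, Set.mem_empty_iff_false]
  simp_rw [h2]
  -- If `e c = x > 0`, clock `c` rings at `x / r c`; the other clocks, of total rate `q - r c`, all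
  -- ring later with this probability. Multiplied by the density `exp (-x)` it becomes `exp (-(q / r
  -- c * x))`.
  let g : ℝ → ℝ≥0∞ := (Set.Ioo 0 (r c * s)).indicator fun x =>
    ENNReal.ofReal (Real.exp (-((q - r c) * (x / r c))))
  have hg : Measurable g := Measurable.indicator (by fun_prop) measurableSet_Ioo
  have h3 : ∫⁻ e, (fun x : ℝ => if ENNReal.ofReal x / ENNReal.ofReal (r c) < ENNReal.ofReal s then
        clockMeasure ι {e' | ∀ c' ∈ S, ENNReal.ofReal x / ENNReal.ofReal (r c) < ring r e' c'}
        else 0) (e c) ∂clockMeasure ι = ∫⁻ e, g (e c) ∂clockMeasure ι := by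
    refine lintegral_congr_ae ?_
    filter_upwards [ae_pos c] with e he
    rw [← ENNReal.ofReal_div_of_pos hc, clockMeasure_forall_lt_ring hr S (by positivity),
      Finset.sum_erase_eq_sub (Finset.mem_univ c)]
    simp only [ENNReal.ofReal_lt_ofReal_iff_of_nonneg (div_pos he hc).le, div_lt_iff₀' hc,
      g, Set.indicator_apply, Set.mem_Ioo, he, true_and, q]
  rw [h3]
  change ∫⁻ e, g (Function.eval c e) ∂Measure.pi (fun _ : ι => expMeasure 1) = _
  rw [(measurePreserving_eval (fun _ : ι => expMeasure 1) c).lintegral_comp hg, expMeasure,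
    gammaMeasure,
    lintegral_withDensity_eq_lintegral_mul (f := gammaPDF 1 1) _
      (measurable_gammaPDFReal 1 1).ennreal_ofReal hg]
  have h4 : ∀ x, (gammaPDF 1 1 * g) x = (Set.Ioo 0 (r c * s)).indicator
      (fun x => ENNReal.ofReal (Real.exp (-(q / r c * x)))) x := by
    intro x
    change exponentialPDF 1 x * g x = _
    by_cases hx : x ∈ Set.Ioo 0 (r c * s)
    · simp only [g, Set.indicator_of_mem hx]
      rw [exponentialPDF_of_nonneg hx.1.le, ← ENNReal.ofReal_mul (by positivity), one_mul,
        one_mul, ← Real.exp_add]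
      congr 2
      field_simp
      ring
    · simp [g, Set.indicator_of_notMem hx]
  simp_rw [h4]
  rw [lintegral_indicator measurableSet_Ioo, lintegral_Ioo_exp (by positivity) (by positivity)]
  congr 1
  field_simp

lemma clockMeasure_winSet {r : ι → ℝ} (hr : ∀ c, 0 ≤ r c) (c : ι) {s : ℝ} (hs : 0 ≤ s) :
    clockMeasure ι (winSet r (ENNReal.ofReal s) c)
      = ENNReal.ofReal (r c * ((1 - Real.exp (-((∑ c, r c) * s))) / ∑ c, r c)) := by
  rcases (hr c).eq_or_lt with hc | hc
  · rw [← hc, zero_mul, ENNReal.ofReal_zero]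
    refine measure_mono_null (t := {e | ¬ 0 < e c}) ?_ (ae_iff.1 (ae_pos c))
    intro e he h
    refine not_lt_of_ge le_top (lt_of_le_of_lt ?_ he.1)
    rw [ring, ← hc, ENNReal.ofReal_zero, ENNReal.div_zero (by simpa using h)]
  · exact clockMeasure_winSet_of_pos hr hc hs

/-- Ties are null by a count of mass: the disjoint winning events already have total probability `1
- exp (-(q * s))`, the full probability of a ring before `s`. -/
lemma ae_exists_mem_winSet [Nonempty ι] {r : ι → ℝ} (hr : ∀ c, 0 ≤ r c) (hq : 0 < ∑ c, r c)
    {s : ℝ} (hs : 0 ≤ s) : ∀ᵐ e ∂clockMeasure ι, firstRing r e < ENNReal.ofReal s →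
      ∃ c, e ∈ winSet r (ENNReal.ofReal s) c := by
  set q := ∑ c, r c with hqdef
  have hqs : 0 ≤ 1 - Real.exp (-(q * s)) := by
    refine sub_nonneg.2 (Real.exp_le_one_iff.2 ?_)
    have := mul_nonneg hq.le hs
    linarith
  have hm : MeasurableSet (⋃ c, winSet r (ENNReal.ofReal s) c) :=
    MeasurableSet.iUnion fun c => measurableSet_winSet r _ c
  have hsub : (⋃ c, winSet r (ENNReal.ofReal s) c) ⊆ {e | firstRing r e < ENNReal.ofReal s} := by
    intro e he
    obtain ⟨c, hc⟩ := Set.mem_iUnion.1 he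
    exact (firstRing_eq_of_mem_winSet hc).trans_lt hc.1
  have h1 : clockMeasure ι (⋃ c, winSet r (ENNReal.ofReal s) c)
      = ENNReal.ofReal (1 - Real.exp (-(q * s))) := by
    rw [measure_iUnion (fun c c' h => disjoint_winSet r _ h)
      (fun c => measurableSet_winSet r _ c), tsum_fintype]
    simp_rw [clockMeasure_winSet hr _ hs]
    rw [← ENNReal.ofReal_sum_of_nonneg
      (fun c _ => mul_nonneg (hr c) (div_nonneg hqs hq.le)), ← Finset.sum_mul]
    congr 1
    rw [← hqdef]
    field_simp
  have h2 : clockMeasure ι {e | firstRing r e < ENNReal.ofReal s}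
      ≤ ENNReal.ofReal (1 - Real.exp (-(q * s))) := by
    rw [ENNReal.ofReal_sub _ (Real.exp_pos _).le, ENNReal.ofReal_one,
      ← clockMeasure_lt_firstRing hr hs, ← prob_compl_eq_one_sub
      (measurableSet_lt measurable_const (measurable_firstRing r))]
    exact measure_mono fun e he h => lt_asymm (a := firstRing r e) he h
  have h3 : clockMeasure ι ({e | firstRing r e < ENNReal.ofReal s} \
      ⋃ c, winSet r (ENNReal.ofReal s) c) = 0 := by
    rw [measure_sdiff hsub hm.nullMeasurableSet (measure_ne_top _ _), h1]
    exact tsub_eq_zero_of_le h2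
  refine measure_mono_null ?_ h3
  intro e he
  have he' : ¬ (firstRing r e < ENNReal.ofReal s →
      ∃ c, e ∈ winSet r (ENNReal.ofReal s) c) := he
  push Not at he'
  exact ⟨he'.1, fun h => by
    obtain ⟨c, hc⟩ := Set.mem_iUnion.1 h
    exact he'.2 c hc⟩

/-- The first clock to ring is `c` with probability proportional to `r c`, independently of the
time at which it rings. -/
theorem integral_firstClock [Nonempty ι] {r : ι → ℝ} (hr : ∀ c, 0 ≤ r c) (hq : 0 < ∑ c, r c)
    {g : (ι → ℝ) → ι} (hg : ∀ e c, (∀ c', c' ≠ c → ring r e c < ring r e c') → g e = c)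
    (φ : ι → ℝ) {s : ℝ≥0∞} (hs : s ≠ ∞) :
    ∫ e, (if firstRing r e < s then φ (g e) else 0) ∂clockMeasure ι
      = (∑ c, r c * φ c) * ∫ e, truncRing r s e ∂clockMeasure ι := by
  obtain ⟨t, ht, rfl⟩ : ∃ t : ℝ, 0 ≤ t ∧ s = ENNReal.ofReal t :=
    ⟨s.toReal, ENNReal.toReal_nonneg, (ENNReal.ofReal_toReal hs).symm⟩
  have h1 : ∀ᵐ e ∂clockMeasure ι, (if firstRing r e < ENNReal.ofReal t then φ (g e) else 0)
      = ∑ c, (winSet r (ENNReal.ofReal t) c).indicator (fun _ => φ c) e := by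
    filter_upwards [ae_exists_mem_winSet hr hq ht] with e he
    split_ifs with h
    · obtain ⟨c, hc⟩ := he h
      rw [hg e c hc.2, Finset.sum_eq_single c, Set.indicator_of_mem hc]
      · intro c' _ hcc
        exact Set.indicator_of_notMem
          (Set.disjoint_left.1 (disjoint_winSet r _ hcc.symm) hc) _
      · simp
    · refine (Finset.sum_eq_zero fun c _ => Set.indicator_of_notMem (fun hc => h ?_) _).symm
      exact (firstRing_eq_of_mem_winSet hc).trans_lt hc.1
  rw [integral_congr_ae h1, integral_finsetSum _ fun c _ =>
    (integrable_const (φ c)).indicator (measurableSet_winSet r _ c), Finset.sum_mul]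
  refine Finset.sum_congr rfl fun c _ => ?_
  -- The winning probability of `c` before `t` is `r c` times `(1 - exp (-(q * t))) / q`, and this
  -- last factor is exactly the truncated mean.
  rw [integral_indicator_const _ (measurableSet_winSet r _ c), Measure.real,
    clockMeasure_winSet hr c ht, integral_truncRing hr hq ht, ENNReal.toReal_ofReal, smul_eq_mul]
  · ring
  · refine mul_nonneg (hr c) (div_nonneg (sub_nonneg.2 (Real.exp_le_one_iff.2 ?_)) hq.le)
    have := mul_nonneg hq.le ht
    linarith

end CompetingClocks

/-! ### The generator of the versions and its Poisson equation -/

namespace Clock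

variable {n : ℕ}

/-- The three kinds of events as a sum type. -/
def equivSum (n : ℕ) : Clock n ≃ (Unit ⊕ Fin n) ⊕ (Fin n × Fin n) where
  toFun
    | .selfUpdate => .inl (.inl ())
    | .source i => .inl (.inr i)
    | .gossip j i => .inr (j, i)
  invFun
    | .inl (.inl _) => .selfUpdate
    | .inl (.inr i) => .source i
    | .inr (j, i) => .gossip j i
  left_inv c := by cases c <;> rfl
  right_inv c := by rcases c with (_ | _) | _ <;> rfl

instance : Fintype (Clock n) := Fintype.ofEquiv _ (equivSum n).symm

instance : Nonempty (Clock n) := ⟨.selfUpdate⟩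

instance : MeasurableSpace (Clock n) := ⊤

instance : DiscreteMeasurableSpace (Clock n) := ⟨fun _ => trivial⟩

lemma sum_eq (f : Clock n → ℝ) :
    ∑ c, f c = f .selfUpdate + ∑ i, f (.source i) + ∑ i, ∑ j, f (.gossip j i) := by
  rw [← (equivSum n).symm.sum_comp, Fintype.sum_sum_type, Fintype.sum_sum_type,
    Fintype.sum_prod_type_right]
  simp [equivSum]

end Clock

namespace NetState

variable {n : ℕ}

instance : MeasurableSpace (NetState n) := ⊤

instance : DiscreteMeasurableSpace (NetState n) := ⟨fun _ => trivial⟩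

instance : Countable (NetState n) :=
  Function.Injective.countable (f := fun x : NetState n => (x.src, x.node)) fun x y h => by
    cases x; cases y; simpa using h

/-! ### Counting fresh nodes and following them through an event. -/

lemma numFresh_le (x : NetState n) : x.numFresh ≤ n := by
  simpa [numFresh] using Finset.card_filter_le (Finset.univ : Finset (Fin n)) fun i => x.IsFresh i

lemma card_stale (x : NetState n) :
    ((Finset.univ.filter fun i => ¬ x.IsFresh i).card : ℝ) = n - x.numFresh := by
  have h := Finset.card_filter_add_card_filter_not (s := (Finset.univ : Finset (Fin n)))
    fun i => x.IsFresh i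
  rw [Finset.card_univ, Fintype.card_fin] at h
  rw [numFresh, eq_sub_iff_add_eq, add_comm]
  exact_mod_cast h

lemma numFresh_lt {x : NetState n} {i : Fin n} (h : ¬ x.IsFresh i) : x.numFresh < n := by
  have h1 : 0 < ((Finset.univ.filter fun i => ¬ x.IsFresh i).card : ℝ) := by
    exact_mod_cast Finset.card_pos.2 ⟨i, by simp [h]⟩
  rw [card_stale] at h1
  exact_mod_cast sub_pos.1 h1

lemma rate_nonneg {le ls lg : ℝ} (hle : 0 ≤ le) (hls : 0 ≤ ls) (hlg : 0 ≤ lg) (x : NetState n)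
    (c : Clock n) : 0 ≤ x.rate le ls lg c := by
  have h : 0 ≤ (n : ℝ) - x.numFresh := sub_nonneg.2 (by exact_mod_cast x.numFresh_le)
  cases c with
  | selfUpdate => exact hle
  | source i =>
    simp only [rate]
    split_ifs
    exacts [le_rfl, div_nonneg hls h]
  | gossip j i =>
    simp only [rate]
    split_ifs
    exacts [div_nonneg hlg h, le_rfl]

lemma isFresh_source_apply {x : NetState n} {i j : Fin n} :
    (x.apply (.source j)).IsFresh i ↔ i = j ∨ x.IsFresh i := by
  by_cases h : i = j
  · simp [IsFresh, apply, h]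
  · simp [IsFresh, apply, h]

lemma apply_gossip {x : NetState n} {i j : Fin n} (h : x.IsFresh j) :
    x.apply (.gossip j i) = x.apply (.source i) := by
  simp only [apply]
  rw [show x.node j = x.src from h]

lemma numFresh_source_apply {x : NetState n} {j : Fin n} (h : ¬ x.IsFresh j) :
    (x.apply (.source j)).numFresh = x.numFresh + 1 := by
  unfold numFresh
  rw [← Finset.card_insert_of_notMem (a := j) (by simp [h])]
  congr 1
  ext i
  simp [isFresh_source_apply]

/-- No node holds a version newer than that of the source. -/
def Valid (x : NetState n) : Prop := ∀ i, x.node i ≤ x.src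

lemma Valid.apply {x : NetState n} (hx : x.Valid) (c : Clock n) : (x.apply c).Valid := by
  intro i
  cases c with
  | selfUpdate => exact (hx i).trans (Nat.le_succ _)
  | source j =>
    by_cases h : i = j
    · simp [NetState.apply, h]
    · simpa [NetState.apply, h] using hx i
  | gossip k j =>
    by_cases h : i = j
    · simpa [NetState.apply, h] using hx k
    · simpa [NetState.apply, h] using hx i

/-- Validity excludes a node already holding version `src + 1`, which the update would make fresh.
-/
lemma Valid.not_isFresh_selfUpdate {x : NetState n} (hx : x.Valid) (i : Fin n) :
    ¬ (x.apply .selfUpdate).IsFresh i := by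
  have := hx i
  simp only [IsFresh, NetState.apply]
  omega

lemma Valid.numFresh_selfUpdate {x : NetState n} (hx : x.Valid) :
    (x.apply .selfUpdate).numFresh = 0 := by
  rw [numFresh, Finset.card_eq_zero, Finset.filter_eq_empty_iff]
  exact fun i _ => hx.not_isFresh_selfUpdate i

/-- The total rate at which stale nodes become fresh when `k < n` nodes are fresh. -/
def refreshRate (ls lg : ℝ) (k : ℕ) : ℝ := ls + k * lg

/-- Sums over the events, for weights that do not depend on the sender of an update. -/
lemma sum_rate_mul (le ls lg : ℝ) (x : NetState n) (ψ : Clock n → ℝ)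
    (hψ : ∀ i j, x.IsFresh j → ψ (.gossip j i) = ψ (.source i)) :
    ∑ c, x.rate le ls lg c * ψ c = le * ψ .selfUpdate +
      refreshRate ls lg x.numFresh / (n - x.numFresh) *
        ∑ i with ¬ x.IsFresh i, ψ (.source i) := by
  rw [Clock.sum_eq, add_assoc, ← Finset.sum_add_distrib, Finset.sum_filter, Finset.mul_sum]
  congr 1
  refine Finset.sum_congr rfl fun i _ => ?_
  by_cases h : x.IsFresh i
  · simp [rate, h]
  · have h1 : ∀ j, x.rate le ls lg (.gossip j i) * ψ (.gossip j i) =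
        if x.IsFresh j then lg / (n - x.numFresh) * ψ (.source i) else 0 := by
      intro j
      by_cases hj : x.IsFresh j <;> simp [rate, h, hj, hψ i j]
    simp_rw [h1]
    rw [← Finset.sum_filter, Finset.sum_const, nsmul_eq_mul]
    simp only [rate, h, if_false, not_false_eq_true, if_true, refreshRate]
    rw [← numFresh]
    ring

lemma sum_rate_pos {le ls lg : ℝ} (hle : 0 < le) (hls : 0 ≤ ls) (hlg : 0 ≤ lg)
    (x : NetState n) : 0 < ∑ c, x.rate le ls lg c :=
  Finset.sum_pos' (fun c _ => rate_nonneg hle.le hls hlg x c) ⟨.selfUpdate, by simp, hle⟩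

lemma sum_rate_le {le ls lg : ℝ} (hls : 0 ≤ ls) (hlg : 0 ≤ lg)
    (x : NetState n) : ∑ c, x.rate le ls lg c ≤ le + (ls + n * lg) := by
  have h := sum_rate_mul le ls lg x (fun _ => 1) (fun _ _ _ => rfl)
  simp only [mul_one, Finset.sum_const, nsmul_eq_mul, card_stale] at h
  rw [h, refreshRate]
  have hk : (x.numFresh : ℝ) ≤ n := by exact_mod_cast x.numFresh_le
  gcongr
  rcases hk.eq_or_lt with hk' | hk'
  · rw [hk', sub_self, mul_zero]
    positivity
  · rw [div_mul_cancel₀ _ (sub_pos.2 hk').ne']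
    gcongr

/-- The expected number of the stale nodes, out of `n - k`, that become fresh before the next
update of the source. -/
def refreshCount (le ls lg : ℝ) (n k : ℕ) : ℝ :=
  ∑ m ∈ Finset.Ico k n, ∏ j ∈ Finset.Ico k (m + 1),
    refreshRate ls lg j / (refreshRate ls lg j + le)

lemma refreshCount_self (le ls lg : ℝ) (n : ℕ) : refreshCount le ls lg n n = 0 := by
  simp [refreshCount]

/-- First-step analysis: the next effective event is a refresh, rather than a source update, with
the probability in front. -/
lemma refreshCount_rec (le ls lg : ℝ) {n k : ℕ} (hk : k < n) :
    refreshCount le ls lg n k = refreshRate ls lg k / (refreshRate ls lg k + le) *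
      (1 + refreshCount le ls lg n (k + 1)) := by
  rw [refreshCount, Finset.sum_eq_sum_Ico_succ_bot hk, mul_add, refreshCount, Finset.mul_sum]
  congr 1
  · simp
  · refine Finset.sum_congr rfl fun m hm => ?_
    rw [Finset.prod_eq_prod_Ico_succ_bot (by have := (Finset.mem_Ico.1 hm).1; omega)]

lemma refreshCount_zero (le ls lg : ℝ) (n : ℕ) :
    refreshCount le ls lg n 0 = ∑ k ∈ Finset.Icc 1 n, ∏ j ∈ Finset.Icc 1 k,
      (ls + ((j : ℝ) - 1) * lg) / (ls + ((j : ℝ) - 1) * lg + le) := by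
  have h (f : ℕ → ℝ) (k : ℕ) : ∏ j ∈ Finset.Icc 1 k, f j = ∏ j ∈ Finset.Ico 0 k, f (j + 1) := by
    rw [Finset.prod_Ico_add' f 0 k 1]
    rfl
  have h' (f : ℕ → ℝ) (k : ℕ) : ∑ j ∈ Finset.Icc 1 k, f j = ∑ j ∈ Finset.Ico 0 k, f (j + 1) := by
    rw [Finset.sum_Ico_add' f 0 k 1]
    rfl
  rw [h', refreshCount]
  refine Finset.sum_congr rfl fun m _ => ?_
  rw [h]
  refine Finset.prod_congr rfl fun j _ => ?_
  simp [refreshRate]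

/-- The expected time that node `i` is fresh before the next update of the source. -/
def freshPotential (le ls lg : ℝ) (i : Fin n) (x : NetState n) : ℝ :=
  if x.IsFresh i then 1 / le
  else refreshCount le ls lg n x.numFresh / ((n - x.numFresh) * le)

lemma exists_abs_freshPotential_le (le ls lg : ℝ) (i : Fin n) :
    ∃ U, ∀ x, |freshPotential le ls lg i x| ≤ U := by
  refine ⟨|1 / le| + ∑ k ∈ Finset.range (n + 1),
    |refreshCount le ls lg n k / ((n - k) * le)|, fun x => ?_⟩
  unfold freshPotential
  split_ifs
  · exact le_add_of_nonneg_right (Finset.sum_nonneg fun _ _ => abs_nonneg _)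
  · refine le_add_of_nonneg_of_le (abs_nonneg _) ?_
    exact Finset.single_le_sum
      (f := fun k : ℕ => |refreshCount le ls lg n k / ((n - k) * le)|)
      (fun _ _ => abs_nonneg _) (Finset.mem_range.2 (Nat.lt_succ_of_le x.numFresh_le))

/-- The Poisson equation for the indicator of freshness of node `i`. -/
theorem generator_freshPotential {le ls lg : ℝ} (hle : 0 < le) (hls : 0 < ls) (hlg : 0 ≤ lg)
    (i : Fin n) {x : NetState n} (hx : x.Valid) :
    ∑ c, x.rate le ls lg c * (freshPotential le ls lg i (x.apply c) - freshPotential le ls lg i x)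
      = 1 / n * refreshCount le ls lg n 0 - if x.IsFresh i then 1 else 0 := by
  have hn : (n : ℝ) ≠ 0 := by
    have := i.pos
    positivity
  rw [sum_rate_mul _ _ _ _ _ fun i j hj => by rw [apply_gossip hj]]
  have h0 : freshPotential le ls lg i (x.apply .selfUpdate)
      = refreshCount le ls lg n 0 / (n * le) := by
    rw [freshPotential, if_neg (hx.not_isFresh_selfUpdate i), hx.numFresh_selfUpdate]
    simp
  rw [h0]
  by_cases h : x.IsFresh i
  · have h1 : ∀ j, freshPotential le ls lg i (x.apply (.source j)) = 1 / le := fun j => by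
      rw [freshPotential, if_pos (isFresh_source_apply.2 (.inr h))]
    simp_rw [h1]
    simp only [freshPotential, h, if_true, sub_self, Finset.sum_const_zero, mul_zero, add_zero]
    field_simp
  · have hk := numFresh_lt h
    set k := x.numFresh with hkdef
    have hk' : (0 : ℝ) < n - k := sub_pos.2 (by exact_mod_cast hk)
    have ha : 0 < refreshRate ls lg k := by
      unfold refreshRate
      positivity
    -- The refreshed node is `i` itself in one term; the other `n - k - 1` terms are equal by
    -- symmetry, and their number cancels the denominator.
    have h1 : ∑ j with ¬ x.IsFresh j, freshPotential le ls lg i (x.apply (.source j))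
        = (1 + refreshCount le ls lg n (k + 1)) / le := by
      have h2 : ∀ j ∈ Finset.univ.filter (fun j => ¬ x.IsFresh j),
          freshPotential le ls lg i (x.apply (.source j)) =
            if j = i then 1 / le else refreshCount le ls lg n (k + 1) / ((n - (k + 1)) * le) := by
        intro j hj
        rw [freshPotential, numFresh_source_apply (Finset.mem_filter.1 hj).2]
        simp [isFresh_source_apply, h, eq_comm, k]
      have hmem : i ∈ Finset.univ.filter (fun j => ¬ x.IsFresh j) := by simp [h]
      rw [Finset.sum_congr rfl h2, ← Finset.add_sum_erase _ _ hmem, if_pos rfl,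
        Finset.sum_congr rfl fun j hj => if_neg (Finset.ne_of_mem_erase hj), Finset.sum_const,
        nsmul_eq_mul, Finset.cast_card_erase_of_mem hmem, card_stale, ← hkdef, add_div]
      congr 1
      -- If `i` is the only stale node, nothing can be cancelled; there are no other terms, and
      -- `refreshCount` vanishes at `n`.
      rcases (Nat.succ_le_of_lt hk).eq_or_lt with h3 | h3
      · rw [Nat.succ_eq_add_one] at h3
        rw [h3, refreshCount_self]
        simp
      · have h4 : (0 : ℝ) < n - (k + 1) := sub_pos.2 (by exact_mod_cast h3)
        rw [sub_sub]
        field_simp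
    rw [Finset.sum_sub_distrib, h1, Finset.sum_const, nsmul_eq_mul, card_stale,
      freshPotential, if_neg h, if_neg h, ← hkdef, refreshCount_rec _ _ _ hk]
    field_simp
    ring

end NetState

/-! ### One step of the jump chain -/

namespace RCGossip

open CompetingClocks

variable {n : ℕ} {le ls lg : ℝ}

lemma firstClock_eq {x : NetState n} {e : Clock n → ℝ} {c : Clock n}
    (h : ∀ c', c' ≠ c → ring (x.rate le ls lg) e c < ring (x.rate le ls lg) e c') :
    firstClock le ls lg x e = c := by
  have hex : ∃ c, ∀ c', c' ≠ c → ringTime le ls lg x e c < ringTime le ls lg x e c' := ⟨c, h⟩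
  rw [firstClock, dif_pos hex]
  by_contra hne
  exact lt_asymm (h _ hne) (hex.choose_spec c (Ne.symm hne))

/-- Describes the fibres of a function defined by choice through explicit inequalities, for the sake
of measurability; the second alternative is the default at ties. -/
lemma firstClock_eq_iff {x : NetState n} {e : Clock n → ℝ} {c : Clock n} :
    firstClock le ls lg x e = c ↔
      (∀ c', c' ≠ c → ring (x.rate le ls lg) e c < ring (x.rate le ls lg) e c') ∨
      c = .selfUpdate ∧ ∀ d, ¬ ∀ c', c' ≠ d →
        ring (x.rate le ls lg) e d < ring (x.rate le ls lg) e c' := by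
  constructor
  · intro h
    by_cases hex : ∃ d, ∀ c', c' ≠ d →
        ring (x.rate le ls lg) e d < ring (x.rate le ls lg) e c'
    · obtain ⟨d, hd⟩ := hex
      rw [firstClock_eq hd] at h
      exact .inl (h ▸ hd)
    · refine .inr ⟨?_, not_exists.1 hex⟩
      rw [← h]
      exact dif_neg hex
  · rintro (h | ⟨rfl, h⟩)
    · exact firstClock_eq h
    · exact dif_neg (not_exists.2 h)

lemma measurable_firstClock (x : NetState n) : Measurable (firstClock le ls lg x) := by
  have hW : ∀ c, MeasurableSet {e : Clock n → ℝ | ∀ c', c' ≠ c →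
      ring (x.rate le ls lg) e c < ring (x.rate le ls lg) e c'} := fun c => by
    simp only [Set.ofPred_forall]
    exact MeasurableSet.iInter fun c' => MeasurableSet.iInter fun _ =>
      measurableSet_lt (measurable_ring _ c) (measurable_ring _ c')
  refine measurable_to_countable' fun c => ?_
  have : firstClock le ls lg x ⁻¹' {c} = {e : Clock n → ℝ | ∀ c', c' ≠ c →
      ring (x.rate le ls lg) e c < ring (x.rate le ls lg) e c'} ∪
      {e : Clock n → ℝ | c = .selfUpdate ∧ ∀ d, ¬ ∀ c', c' ≠ d →
        ring (x.rate le ls lg) e d < ring (x.rate le ls lg) e c'} := by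
    ext e
    exact firstClock_eq_iff
  rw [this]
  refine (hW c).union ?_
  rw [Set.ofPred_and, Set.ofPred_forall]
  exact (MeasurableSet.const _).inter (MeasurableSet.iInter fun d => (hW d).compl)

/-- The versions after `m` events together with the time of the `m`-th event. -/
def jump (le ls lg : ℝ) (x₀ : NetState n) (m : ℕ) (ξ : ℕ → Clock n → ℝ) : NetState n × ℝ≥0∞ :=
  (jumpChain le ls lg x₀ ξ m, jumpTime le ls lg x₀ ξ m)

/-- The effect of the next event. -/
def step (le ls lg : ℝ) (p : (NetState n × ℝ≥0∞) × (Clock n → ℝ)) : NetState n × ℝ≥0∞ :=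
  (p.1.1.apply (firstClock le ls lg p.1.1 p.2), p.1.2 + firstRing (p.1.1.rate le ls lg) p.2)

lemma jump_succ (x₀ : NetState n) (m : ℕ) (ξ : ℕ → Clock n → ℝ) :
    jump le ls lg x₀ (m + 1) ξ = step le ls lg (jump le ls lg x₀ m ξ, ξ m) := rfl

lemma measurable_firstClock_prod :
    Measurable fun p : NetState n × (Clock n → ℝ) => firstClock le ls lg p.1 p.2 :=
  measurable_from_prod_countable_right measurable_firstClock

lemma measurable_firstRing_prod :
    Measurable fun p : NetState n × (Clock n → ℝ) => firstRing (p.1.rate le ls lg) p.2 :=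
  measurable_from_prod_countable_right
    (f := fun p : NetState n × (Clock n → ℝ) => firstRing (p.1.rate le ls lg) p.2)
    fun x => measurable_firstRing (x.rate le ls lg)

lemma measurable_step : Measurable (step (n := n) le ls lg) := by
  have h : Measurable fun p : (NetState n × ℝ≥0∞) × (Clock n → ℝ) => (p.1.1, p.2) := by fun_prop
  have h1 : Measurable fun q : NetState n × Clock n => q.1.apply q.2 := measurable_of_countable _
  exact (h1.comp ((measurable_fst.comp measurable_fst).prodMk
    (measurable_firstClock_prod.comp h))).prodMk
    ((measurable_snd.comp measurable_fst).add (measurable_firstRing_prod.comp h))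

lemma measurable_jump (x₀ : NetState n) (m : ℕ) : Measurable (jump le ls lg x₀ m) := by
  induction m with
  | zero =>
    exact (measurable_const : Measurable fun _ : ℕ → Clock n → ℝ => (x₀, (0 : ℝ≥0∞)))
  | succ m ih => exact measurable_step.comp (ih.prodMk (measurable_pi_apply m))

lemma jump_congr (x₀ : NetState n) {m : ℕ} {ξ ξ' : ℕ → Clock n → ℝ} (h : ∀ k < m, ξ k = ξ' k) :
    jump le ls lg x₀ m ξ = jump le ls lg x₀ m ξ' := by
  induction m with
  | zero => rfl
  | succ m ih =>
    rw [jump_succ, jump_succ, ih fun k hk => h k (hk.trans m.lt_succ_self), h m m.lt_succ_self]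

/-! ### Independence of the past from the next clocks. -/

section Probability

variable {Ω : Type*} [MeasurableSpace Ω] {P : Measure Ω}
  {ξ : ℕ → Clock n → Ω → ℝ}

lemma map_clocks [IsProbabilityMeasure P] (hm : ∀ m c, Measurable (ξ m c))
    (hlaw : ∀ m c, P.map (ξ m c) = expMeasure 1)
    (hindep : iIndepFun (fun a : ℕ × Clock n => ξ a.1 a.2) P) (m : ℕ) :
    P.map (fun ω c => ξ m c ω) = clockMeasure (Clock n) := by
  have h := hindep.precomp (g := fun c : Clock n => (m, c)) fun c c' h => by simpa using h
  rw [iIndepFun_iff_map_fun_eq_pi_map fun c => (hm m c).aemeasurable] at h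
  rw [clockMeasure, h]
  simp_rw [hlaw]

/-- The first `m` events use only the finite block of clocks with index below `m`, disjoint from the
block of index `m`. -/
lemma indepFun_jump (hm : ∀ m c, Measurable (ξ m c))
    (hindep : iIndepFun (fun a : ℕ × Clock n => ξ a.1 a.2) P) (x₀ : NetState n) (m : ℕ) :
    IndepFun (fun ω => jump le ls lg x₀ m fun k c => ξ k c ω) (fun ω c => ξ m c ω) P := by
  classical
  let S : Finset (ℕ × Clock n) := Finset.range m ×ˢ Finset.univ
  let S' : Finset (ℕ × Clock n) := {m} ×ˢ Finset.univ
  have hdisj : Disjoint S S' := by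
    rw [Finset.disjoint_left]
    intro a ha hb
    simp only [S, S', Finset.mem_product, Finset.mem_range, Finset.mem_singleton] at ha hb
    omega
  have h := hindep.indepFun_finset S S' hdisj fun a => hm a.1 a.2
  -- Extends a finite block by zero to a full family; by `jump_congr` the added values are never
  -- seen.
  have hext : Measurable fun (p : S → ℝ) (k : ℕ) (c : Clock n) =>
      if h : (k, c) ∈ S then p ⟨(k, c), h⟩ else 0 := by
    refine measurable_pi_lambda _ fun k => measurable_pi_lambda _ fun c => ?_
    by_cases hS : (k, c) ∈ S
    · simpa only [hS, dif_pos] using measurable_pi_apply _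
    · simp only [hS, dif_neg, not_false_eq_true, measurable_const]
  have h2 := h.comp ((measurable_jump (le := le) (ls := ls) (lg := lg) x₀ m).comp hext)
    (ψ := fun (p : S' → ℝ) (c : Clock n) => p ⟨(m, c), by simp [S']⟩) (by fun_prop)
  refine h2.congr (ae_of_all _ fun ω => ?_) (ae_of_all _ fun ω => rfl)
  symm
  refine jump_congr x₀ fun k hk => ?_
  ext c
  simp [S, hk]

lemma integral_step [IsProbabilityMeasure P] (hm : ∀ m c, Measurable (ξ m c))
    (hlaw : ∀ m c, P.map (ξ m c) = expMeasure 1)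
    (hindep : iIndepFun (fun a : ℕ × Clock n => ξ a.1 a.2) P) (x₀ : NetState n) (m : ℕ)
    {f : (NetState n × ℝ≥0∞) × (Clock n → ℝ) → ℝ} (hf : Measurable f) {K : ℝ}
    (hK : ∀ p, |f p| ≤ K) :
    ∫ ω, f (jump le ls lg x₀ m fun k c => ξ k c ω, fun c => ξ m c ω) ∂P
      = ∫ ω, ∫ e, f (jump le ls lg x₀ m fun k c => ξ k c ω, e) ∂clockMeasure (Clock n) ∂P := by
  have hZ : Measurable fun ω => jump le ls lg x₀ m fun k c => ξ k c ω :=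
    (measurable_jump x₀ m).comp (measurable_pi_lambda _ fun k => measurable_pi_lambda _ (hm k))
  have he : Measurable fun ω c => ξ m c ω := measurable_pi_lambda _ (hm m)
  rw [← integral_map (φ := fun ω => (jump le ls lg x₀ m fun k c => ξ k c ω, fun c => ξ m c ω))
    (hZ.prodMk he).aemeasurable hf.aestronglyMeasurable,
    (indepFun_jump hm hindep x₀ m).map_prod_eq_prod_map_map hZ.aemeasurable he.aemeasurable,
    map_clocks hm hlaw hindep]
  have := Measure.isProbabilityMeasure_map (μ := P) hZ.aemeasurable
  rw [integral_prod _ (Integrable.of_bound hf.aestronglyMeasurable K (ae_of_all _ hK)),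
    integral_map hZ.aemeasurable]
  exact hf.stronglyMeasurable.integral_prod_right'.aestronglyMeasurable

/-- The part of the `m`-th holding time that falls before time `T`. -/
def holdingTime (le ls lg : ℝ) (x₀ : NetState n) (T : ℝ≥0∞) (m : ℕ)
    (ξ : ℕ → Clock n → ℝ) : ℝ :=
  truncRing ((jumpChain le ls lg x₀ ξ m).rate le ls lg) (T - jumpTime le ls lg x₀ ξ m) (ξ m)

lemma measurable_truncRing_prod (T : ℝ≥0∞) :
    Measurable fun p : (NetState n × ℝ≥0∞) × (Clock n → ℝ) =>
      truncRing (p.1.1.rate le ls lg) (T - p.1.2) p.2 := by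
  have h : Measurable fun p : (NetState n × ℝ≥0∞) × (Clock n → ℝ) => (p.1.1, p.2) := by fun_prop
  exact ((measurable_firstRing_prod.comp h).min (by fun_prop)).ennreal_toReal

/-- A weighted event before time `T` has the expected weight of the next event, times the expected
holding time before `T`. -/
theorem integral_event [IsProbabilityMeasure P] (hle : 0 < le) (hls : 0 ≤ ls)
    (hlg : 0 ≤ lg)
    (hm : ∀ m c, Measurable (ξ m c)) (hlaw : ∀ m c, P.map (ξ m c) = expMeasure 1)
    (hindep : iIndepFun (fun a : ℕ × Clock n => ξ a.1 a.2) P) (x₀ : NetState n) (m : ℕ)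
    {T : ℝ≥0∞} (hT : T ≠ ∞) (φ : NetState n → Clock n → ℝ) {K : ℝ} (hK : ∀ x c, |φ x c| ≤ K) :
    Integrable (fun ω => if jumpTime le ls lg x₀ (fun k c => ξ k c ω) (m + 1) < T then
        φ (jumpChain le ls lg x₀ (fun k c => ξ k c ω) m)
          (firstClock le ls lg (jumpChain le ls lg x₀ (fun k c => ξ k c ω) m) fun c => ξ m c ω)
        else 0) P ∧
    Integrable (fun ω => (∑ c, (jumpChain le ls lg x₀ (fun k c => ξ k c ω) m).rate le ls lg c *
          φ (jumpChain le ls lg x₀ (fun k c => ξ k c ω) m) c) *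
          holdingTime le ls lg x₀ T m (fun k c => ξ k c ω)) P ∧
    ∫ ω, (if jumpTime le ls lg x₀ (fun k c => ξ k c ω) (m + 1) < T then
        φ (jumpChain le ls lg x₀ (fun k c => ξ k c ω) m)
          (firstClock le ls lg (jumpChain le ls lg x₀ (fun k c => ξ k c ω) m) fun c => ξ m c ω)
        else 0) ∂P
      = ∫ ω, (∑ c, (jumpChain le ls lg x₀ (fun k c => ξ k c ω) m).rate le ls lg c *
          φ (jumpChain le ls lg x₀ (fun k c => ξ k c ω) m) c) *
          holdingTime le ls lg x₀ T m (fun k c => ξ k c ω) ∂P := by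
  have hK0 : 0 ≤ K := (abs_nonneg _).trans (hK x₀ .selfUpdate)
  have h : Measurable fun p : (NetState n × ℝ≥0∞) × (Clock n → ℝ) => (p.1.1, p.2) := by fun_prop
  have h1 : Measurable fun q : NetState n × Clock n => φ q.1 q.2 := measurable_of_countable _
  let f1 : (NetState n × ℝ≥0∞) × (Clock n → ℝ) → ℝ := fun p =>
    if (step le ls lg p).2 < T then φ p.1.1 (firstClock le ls lg p.1.1 p.2) else 0
  let f2 : (NetState n × ℝ≥0∞) × (Clock n → ℝ) → ℝ := fun p =>
    (∑ c, p.1.1.rate le ls lg c * φ p.1.1 c) * truncRing (p.1.1.rate le ls lg) (T - p.1.2) p.2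
  have hf1 : Measurable f1 := Measurable.ite
    (measurableSet_lt (measurable_snd.comp measurable_step) measurable_const)
    (h1.comp ((measurable_fst.comp measurable_fst).prodMk (measurable_firstClock_prod.comp h)))
    measurable_const
  have h2 : Measurable fun x : NetState n => ∑ c, x.rate le ls lg c * φ x c :=
    measurable_of_countable _
  have hf2 : Measurable f2 :=
    (h2.comp (measurable_fst.comp measurable_fst)).mul (measurable_truncRing_prod T)
  have hb1 : ∀ p, |f1 p| ≤ K := by
    intro p
    simp only [f1]
    split_ifs
    · exact hK _ _
    · simpa using hK0
  have hb2 : ∀ p, |f2 p| ≤ ((le + (ls + n * lg)) * K) * T.toReal := by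
    intro p
    rw [abs_mul, abs_of_nonneg (truncRing_nonneg _ _ _)]
    refine mul_le_mul ?_ ((truncRing_le _ (ne_top_of_le_ne_top hT tsub_le_self) _).trans
      (ENNReal.toReal_mono hT tsub_le_self)) (truncRing_nonneg _ _ _) (by positivity)
    refine (Finset.abs_sum_le_sum_abs _ _).trans ((Finset.sum_le_sum fun c _ => ?_).trans
      ((Finset.sum_mul Finset.univ (p.1.1.rate le ls lg) K).symm.le.trans
      (mul_le_mul_of_nonneg_right (p.1.1.sum_rate_le hls hlg) hK0)))
    have hr := p.1.1.rate_nonneg hle.le hls hlg c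
    rw [abs_mul, abs_of_nonneg hr]
    exact mul_le_mul_of_nonneg_left (hK _ _) hr
  have e1 := integral_step hm hlaw hindep (le := le) (ls := ls) (lg := lg) x₀ m hf1 hb1
  have e2 := integral_step hm hlaw hindep (le := le) (ls := ls) (lg := lg) x₀ m hf2 hb2
  have hZ : Measurable fun ω =>
      (jump le ls lg x₀ m fun k c => ξ k c ω, fun c => ξ m c ω) :=
    ((measurable_jump x₀ m).comp
      (measurable_pi_lambda _ fun k => measurable_pi_lambda _ (hm k))).prodMk
      (measurable_pi_lambda _ (hm m))
  have i1 : Integrable (fun ω =>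
      f1 (jump le ls lg x₀ m fun k c => ξ k c ω, fun c => ξ m c ω)) P :=
    Integrable.of_bound (hf1.comp hZ).aestronglyMeasurable K (ae_of_all _ fun ω => hb1 _)
  have i2 : Integrable (fun ω =>
      f2 (jump le ls lg x₀ m fun k c => ξ k c ω, fun c => ξ m c ω)) P :=
    Integrable.of_bound (hf2.comp hZ).aestronglyMeasurable _ (ae_of_all _ fun ω => hb2 _)
  refine ⟨i1, i2, e1.trans (Eq.trans ?_ e2.symm)⟩
  congr 1
  ext1 ω
  simp only [f1, f2, step]
  -- With the past frozen, the next event precedes `T` when the first ring precedes `T - jumpTime`.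
  -- Truncated subtraction makes this bound zero if `T` is already passed, and both sides then
  -- vanish.
  rw [integral_const_mul, ← integral_firstClock
    (fun c => NetState.rate_nonneg hle.le hls hlg _ c) (NetState.sum_rate_pos hle hls hlg _)
    (fun e c h => firstClock_eq h) _ (ne_top_of_le_ne_top hT tsub_le_self)]
  simp only [lt_tsub_iff_left]
  rfl

end Probability

end RCGossip

/-! ### Paths of the chain -/

namespace RCGossip

open CompetingClocks

variable {n : ℕ} {le ls lg : ℝ}

lemma jumpTime_succ (x₀ : NetState n) (ξ : ℕ → Clock n → ℝ) (m : ℕ) :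
    jumpTime le ls lg x₀ ξ (m + 1) = jumpTime le ls lg x₀ ξ m +
      firstRing ((jumpChain le ls lg x₀ ξ m).rate le ls lg) (ξ m) := rfl

lemma monotone_jumpTime (x₀ : NetState n) (ξ : ℕ → Clock n → ℝ) :
    Monotone (jumpTime le ls lg x₀ ξ) :=
  monotone_nat_of_le_succ fun _ => le_self_add

lemma valid_jumpChain {x₀ : NetState n} (hx₀ : x₀.Valid) (ξ : ℕ → Clock n → ℝ) (m : ℕ) :
    (jumpChain le ls lg x₀ ξ m).Valid := by
  induction m with
  | zero => exact hx₀
  | succ m ih => exact ih.apply _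

lemma numEvents_eq {x₀ : NetState n} {ξ : ℕ → Clock n → ℝ} {t : ℝ} {m : ℕ}
    (h1 : ∀ k < m, jumpTime le ls lg x₀ ξ (k + 1) ≤ ENNReal.ofReal t)
    (h2 : ENNReal.ofReal t < jumpTime le ls lg x₀ ξ (m + 1)) :
    numEvents le ls lg x₀ ξ t = m := by
  have : {k : ℕ | jumpTime le ls lg x₀ ξ (k + 1) ≤ ENNReal.ofReal t} = Finset.range m := by
    ext k
    simp only [Set.mem_ofPred_eq, Finset.coe_range, Set.mem_Iio]
    refine ⟨fun h => ?_, h1 k⟩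
    by_contra hk
    exact absurd (h2.trans_le (monotone_jumpTime x₀ ξ (by omega : m + 1 ≤ k + 1))) h.not_gt
  rw [numEvents, this, Set.ncard_coe_finset, Finset.card_range]

/-- On an exploding path the set of events is infinite, and `Set.ncard` takes its default value `0`.
-/
lemma numEvents_eq_zero {x₀ : NetState n} {ξ : ℕ → Clock n → ℝ} {t : ℝ}
    (h : ∀ k, jumpTime le ls lg x₀ ξ (k + 1) ≤ ENNReal.ofReal t) :
    numEvents le ls lg x₀ ξ t = 0 := by
  simp [numEvents, h, Set.ncard_univ]

/-- The indicator that node `i` is fresh. -/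
def freshIndicator (i : Fin n) (x : NetState n) : ℝ := if x.IsFresh i then 1 else 0

lemma freshIndicator_mem (i : Fin n) (x : NetState n) : freshIndicator i x ∈ Set.Icc (0 : ℝ) 1 := by
  unfold freshIndicator
  split_ifs <;> simp

lemma freshness_eq (x₀ : NetState n) (ξ : ℕ → Clock n → ℝ) (i : Fin n) (t : ℝ) :
    freshness le ls lg x₀ ξ i t
      = freshIndicator i (jumpChain le ls lg x₀ ξ (numEvents le ls lg x₀ ξ t)) := rfl

lemma freshness_mem (x₀ : NetState n) (ξ : ℕ → Clock n → ℝ) (i : Fin n) (t : ℝ) :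
    freshness le ls lg x₀ ξ i t ∈ Set.Icc (0 : ℝ) 1 := freshIndicator_mem i _

lemma measurable_freshness (x₀ : NetState n) (i : Fin n) :
    Measurable fun q : ℝ × (ℕ → Clock n → ℝ) => freshness le ls lg x₀ q.2 i q.1 := by
  classical
  -- The second alternative makes the least `k` equal to `0` on exploding paths, in agreement with
  -- the default of `numEvents`; measurability is thus proved for every path.
  let p : ℕ → ℝ × (ℕ → Clock n → ℝ) → Prop := fun k q =>
    ENNReal.ofReal q.1 < jumpTime le ls lg x₀ q.2 (k + 1) ∨
      ∀ l, jumpTime le ls lg x₀ q.2 (l + 1) ≤ ENNReal.ofReal q.1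
  have hp : ∀ q, ∃ k, p k q := fun q => by
    by_cases h : ∃ k, ENNReal.ofReal q.1 < jumpTime le ls lg x₀ q.2 (k + 1)
    · exact h.imp fun _ => .inl
    · exact ⟨0, .inr fun l => not_lt.1 (not_exists.1 h l)⟩
  have hτ : ∀ k, Measurable fun q : ℝ × (ℕ → Clock n → ℝ) => jumpTime le ls lg x₀ q.2 k :=
    fun k => measurable_snd.comp ((measurable_jump x₀ k).comp measurable_snd)
  have ht : Measurable fun q : ℝ × (ℕ → Clock n → ℝ) => ENNReal.ofReal q.1 := by fun_prop
  have hpm : ∀ k, MeasurableSet {q | p k q} := fun k => by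
    simp only [p, Set.ofPred_or, Set.ofPred_forall]
    exact (measurableSet_lt ht (hτ _)).union
      (MeasurableSet.iInter fun l => measurableSet_le (hτ _) ht)
  have hf : ∀ k, Measurable fun q : ℝ × (ℕ → Clock n → ℝ) =>
      freshIndicator i (jumpChain le ls lg x₀ q.2 k) := fun k =>
    (measurable_of_countable (freshIndicator i)).comp
      (measurable_fst.comp ((measurable_jump x₀ k).comp measurable_snd))
  convert Measurable.find hf hpm hp using 1
  ext q
  rw [freshness_eq]
  congr 2
  by_cases h : ∀ l, jumpTime le ls lg x₀ q.2 (l + 1) ≤ ENNReal.ofReal q.1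
  · rw [numEvents_eq_zero h, eq_comm, Nat.find_eq_zero]
    exact .inr h
  · refine numEvents_eq (fun k hk => ?_) ((Nat.find_spec (hp q)).resolve_right h)
    exact not_lt.1 (not_or.1 (Nat.find_min (hp q) hk)).1

/-! ### Splitting the time integral at the truncated event times. -/

/-- The time of the `m`-th event, truncated at `T`. -/
def truncTime (le ls lg : ℝ) (x₀ : NetState n) (T : ℝ≥0∞) (m : ℕ) (ξ : ℕ → Clock n → ℝ) : ℝ :=
  (min (jumpTime le ls lg x₀ ξ m) T).toReal

lemma truncTime_zero (x₀ : NetState n) (T : ℝ≥0∞) (ξ : ℕ → Clock n → ℝ) :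
    truncTime le ls lg x₀ T 0 ξ = 0 := by
  simp [truncTime, jumpTime]

lemma truncTime_succ (x₀ : NetState n) {T : ℝ≥0∞} (hT : T ≠ ∞) (m : ℕ) (ξ : ℕ → Clock n → ℝ) :
    truncTime le ls lg x₀ T (m + 1) ξ
      = truncTime le ls lg x₀ T m ξ + holdingTime le ls lg x₀ T m ξ := by
  rw [truncTime, truncTime, holdingTime, truncRing, ← ENNReal.toReal_add
    (ne_top_of_le_ne_top hT (min_le_right _ _))
    (ne_top_of_le_ne_top hT ((min_le_right _ _).trans tsub_le_self)), jumpTime_succ]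
  congr 1
  rcases le_total (jumpTime le ls lg x₀ ξ m) T with h | h
  · rw [min_eq_left h, ← min_add_add_left, add_tsub_cancel_of_le h]
  · rw [tsub_eq_zero_of_le h, min_eq_right (h.trans le_self_add), min_eq_right h]
    simp

lemma sum_holdingTime (x₀ : NetState n) {T : ℝ≥0∞} (hT : T ≠ ∞) (m : ℕ) (ξ : ℕ → Clock n → ℝ) :
    ∑ k ∈ Finset.range m, holdingTime le ls lg x₀ T k ξ = truncTime le ls lg x₀ T m ξ := by
  induction m with
  | zero => rw [truncTime_zero, Finset.sum_range_zero]
  | succ m ih => rw [Finset.sum_range_succ, ih, truncTime_succ x₀ hT]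

lemma holdingTime_nonneg (x₀ : NetState n) (T : ℝ≥0∞) (m : ℕ) (ξ : ℕ → Clock n → ℝ) :
    0 ≤ holdingTime le ls lg x₀ T m ξ := truncRing_nonneg _ _ _

lemma truncTime_mem (x₀ : NetState n) {T : ℝ} (hT : 0 ≤ T) (m : ℕ) (ξ : ℕ → Clock n → ℝ) :
    truncTime le ls lg x₀ (ENNReal.ofReal T) m ξ ∈ Set.Icc 0 T := by
  refine ⟨ENNReal.toReal_nonneg, ?_⟩
  rw [← ENNReal.toReal_ofReal hT]
  simpa [truncTime, hT] using ENNReal.toReal_mono ENNReal.ofReal_ne_top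
    (min_le_right (jumpTime le ls lg x₀ ξ m) (ENNReal.ofReal T))

lemma truncTime_of_le (x₀ : NetState n) {T : ℝ} (hT : 0 ≤ T) {m : ℕ} {ξ : ℕ → Clock n → ℝ}
    (h : ENNReal.ofReal T ≤ jumpTime le ls lg x₀ ξ m) :
    truncTime le ls lg x₀ (ENNReal.ofReal T) m ξ = T := by
  rw [truncTime, min_eq_right h, ENNReal.toReal_ofReal hT]

/-- A point of this interval lies after event `m` and before event `m + 1`; the interval is empty
once `T` is passed. -/
lemma freshness_of_mem_Ioo {x₀ : NetState n} {T : ℝ} {m : ℕ} {ξ : ℕ → Clock n → ℝ} (i : Fin n)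
    {t : ℝ} (ht : t ∈ Set.Ioo (truncTime le ls lg x₀ (ENNReal.ofReal T) m ξ)
      (truncTime le ls lg x₀ (ENNReal.ofReal T) (m + 1) ξ)) :
    freshness le ls lg x₀ ξ i t = freshIndicator i (jumpChain le ls lg x₀ ξ m) := by
  have h0 : 0 ≤ t := ENNReal.toReal_nonneg.trans ht.1.le
  have h2 := (ENNReal.ofReal_lt_iff_lt_toReal h0
    (ne_top_of_le_ne_top ENNReal.ofReal_ne_top (min_le_right _ _))).2 ht.2
  have h1 := (ENNReal.lt_ofReal_iff_toReal_lt
    (ne_top_of_le_ne_top ENNReal.ofReal_ne_top (min_le_right _ _))).2 ht.1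
  rw [lt_min_iff] at h2
  rw [min_lt_iff] at h1
  have h1' := h1.resolve_right h2.2.not_gt
  rw [freshness_eq, numEvents_eq (fun k hk => ?_) h2.1]
  exact (monotone_jumpTime x₀ ξ (Nat.succ_le_of_lt hk)).trans h1'.le

lemma integral_freshness_truncTime (x₀ : NetState n) (T : ℝ) (m : ℕ) (ξ : ℕ → Clock n → ℝ)
    (i : Fin n) :
    ∫ t in (0 : ℝ)..truncTime le ls lg x₀ (ENNReal.ofReal T) m ξ, freshness le ls lg x₀ ξ i t
      = ∑ k ∈ Finset.range m, freshIndicator i (jumpChain le ls lg x₀ ξ k) *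
          holdingTime le ls lg x₀ (ENNReal.ofReal T) k ξ := by
  set b := fun k => truncTime le ls lg x₀ (ENNReal.ofReal T) k ξ with hb
  have hsucc : ∀ k, b (k + 1) = b k + holdingTime le ls lg x₀ (ENNReal.ofReal T) k ξ :=
    fun k => truncTime_succ x₀ ENNReal.ofReal_ne_top k ξ
  have hmono : ∀ k, b k ≤ b (k + 1) := fun k => by
    rw [hsucc]
    exact le_add_of_nonneg_right (holdingTime_nonneg _ _ _ _)
  have hae : ∀ k, ∀ᵐ t ∂volume.restrict (Set.uIoc (b k) (b (k + 1))),
      freshIndicator i (jumpChain le ls lg x₀ ξ k) = freshness le ls lg x₀ ξ i t := fun k => by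
    rw [Set.uIoc_of_le (hmono k), ← restrict_Ioo_eq_restrict_Ioc]
    filter_upwards [ae_restrict_mem measurableSet_Ioo] with t ht
    exact (freshness_of_mem_Ioo i ht).symm
  have h0 : b 0 = 0 := truncTime_zero _ _ _
  change ∫ t in (0 : ℝ)..b m, freshness le ls lg x₀ ξ i t = _
  rw [← h0, ← intervalIntegral.sum_integral_adjacent_intervals]
  · refine Finset.sum_congr rfl fun k _ => ?_
    rw [← intervalIntegral.integral_congr_ae_restrict (hae k), intervalIntegral.integral_const,
      hsucc, add_sub_cancel_left, smul_eq_mul, mul_comm]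
  · exact fun k _ => (intervalIntegrable_const (c := freshIndicator i
      (jumpChain le ls lg x₀ ξ k))).congr_ae (hae k)

/-- Up to the event that fewer than `m` events occur before `T`, the deviation of the time that
node `i` is fresh is a sum over the holding times. -/
lemma abs_integral_freshness_sub_le (x₀ : NetState n) {T : ℝ} (hT : 0 ≤ T) (m : ℕ)
    (ξ : ℕ → Clock n → ℝ) (i : Fin n) (a : ℝ) :
    |(∫ t in (0 : ℝ)..T, freshness le ls lg x₀ ξ i t) - a * T +
      ∑ k ∈ Finset.range m, (a - freshIndicator i (jumpChain le ls lg x₀ ξ k)) *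
          holdingTime le ls lg x₀ (ENNReal.ofReal T) k ξ|
      ≤ if jumpTime le ls lg x₀ ξ m < ENNReal.ofReal T then (1 + |a|) * T else 0 := by
  have hsum : ∑ k ∈ Finset.range m, (a - freshIndicator i (jumpChain le ls lg x₀ ξ k)) *
      holdingTime le ls lg x₀ (ENNReal.ofReal T) k ξ
      = a * truncTime le ls lg x₀ (ENNReal.ofReal T) m ξ -
        ∫ t in (0 : ℝ)..truncTime le ls lg x₀ (ENNReal.ofReal T) m ξ,
          freshness le ls lg x₀ ξ i t := by
    rw [integral_freshness_truncTime, ← sum_holdingTime x₀ ENNReal.ofReal_ne_top, Finset.mul_sum,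
      ← Finset.sum_sub_distrib]
    exact Finset.sum_congr rfl fun k _ => sub_mul _ _ _
  rw [hsum]
  have hb := truncTime_mem (le := le) (ls := ls) (lg := lg) x₀ hT m ξ
  split_ifs with h
  · set b := truncTime le ls lg x₀ (ENNReal.ofReal T) m ξ
    have hint : ∀ s, 0 ≤ s → (∫ t in (0 : ℝ)..s, freshness le ls lg x₀ ξ i t) ∈ Set.Icc 0 s :=
      fun s hs => by
        refine ⟨intervalIntegral.integral_nonneg hs fun t _ => (freshness_mem x₀ ξ i t).1, ?_⟩
        have h1 := intervalIntegral.norm_integral_le_of_norm_le_const (a := 0) (b := s) (C := 1)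
          (f := freshness le ls lg x₀ ξ i) fun t _ => by
            rw [Real.norm_of_nonneg (freshness_mem x₀ ξ i t).1]
            exact (freshness_mem x₀ ξ i t).2
        rw [sub_zero, abs_of_nonneg hs, one_mul] at h1
        exact (le_abs_self _).trans h1
    have hi : |(∫ t in (0 : ℝ)..T, freshness le ls lg x₀ ξ i t) -
        ∫ t in (0 : ℝ)..b, freshness le ls lg x₀ ξ i t| ≤ T := by
      have h1 := hint T hT
      have h2 := hint b hb.1
      rw [abs_le]
      constructor <;> linarith [h1.1, h1.2, h2.1, h2.2, hb.2]
    have ha : |a * (b - T)| ≤ |a| * T := by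
      rw [abs_mul]
      refine mul_le_mul_of_nonneg_left ?_ (abs_nonneg a)
      rw [abs_le]
      constructor <;> linarith [hb.1, hb.2]
    calc _ = |((∫ t in (0 : ℝ)..T, freshness le ls lg x₀ ξ i t) -
        ∫ t in (0 : ℝ)..b, freshness le ls lg x₀ ξ i t) + a * (b - T)| := by
          congr 1
          ring
      _ ≤ _ := (abs_add_le _ _).trans (by linarith)
  -- When the `m`-th event is not before `T`, the holding times fill `[0, T]` and the deviation is
  -- exactly zero.
  · rw [truncTime_of_le x₀ hT (not_lt.1 h)]
    simp

/-- Event times are monotone, so the retained increments form an initial segment. The induction also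
records that `l = m` while the `m`-th event is before `T`. -/
lemma exists_sum_telescope (x₀ : NetState n) (T : ℝ≥0∞) (m : ℕ) (ξ : ℕ → Clock n → ℝ)
    (u : ℕ → ℝ) : ∃ l, ∑ k ∈ Finset.range m,
      (if jumpTime le ls lg x₀ ξ (k + 1) < T then u (k + 1) - u k else 0) = u l - u 0 := by
  suffices h : ∃ l, ∑ k ∈ Finset.range m,
      (if jumpTime le ls lg x₀ ξ (k + 1) < T then u (k + 1) - u k else 0) = u l - u 0 ∧
      (jumpTime le ls lg x₀ ξ m < T → l = m) from h.imp fun _ => And.left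
  induction m with
  | zero => exact ⟨0, by simp⟩
  | succ m ih =>
    obtain ⟨l, hl, hlm⟩ := ih
    rw [Finset.sum_range_succ, hl]
    by_cases h : jumpTime le ls lg x₀ ξ (m + 1) < T
    · rw [if_pos h, hlm ((monotone_jumpTime x₀ ξ m.le_succ).trans_lt h)]
      exact ⟨m + 1, by ring, fun _ => rfl⟩
    · rw [if_neg h]
      exact ⟨l, by ring, fun h' => absurd h' h⟩

/-! ### The expected time that a node is fresh -/

section Probability

variable {Ω : Type*} [MeasurableSpace Ω] {P : Measure Ω} [IsProbabilityMeasure P]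
  {ξ : ℕ → Clock n → Ω → ℝ}

lemma integrable_freshness (hm : ∀ m c, Measurable (ξ m c)) (x₀ : NetState n) (i : Fin n)
    (T : ℝ) : Integrable
      (fun q : ℝ × Ω => freshness le ls lg x₀ (fun m c => ξ m c q.2) i q.1)
      ((volume.restrict (Set.Ioc 0 T)).prod P) := by
  have h : Measurable fun q : ℝ × Ω => (q.1, fun m c => ξ m c q.2) :=
    measurable_fst.prodMk (measurable_pi_lambda _ fun m => measurable_pi_lambda _ fun c =>
      (hm m c).comp measurable_snd)
  refine Integrable.of_bound ((measurable_freshness x₀ i).comp h).aestronglyMeasurable 1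
    (ae_of_all _ fun q => ?_)
  have := freshness_mem (le := le) (ls := ls) (lg := lg) x₀ (fun m c => ξ m c q.2) i q.1
  rw [Real.norm_of_nonneg this.1]
  exact this.2

lemma measurable_jumpTime (hm : ∀ m c, Measurable (ξ m c)) (x₀ : NetState n) (m : ℕ) :
    Measurable fun ω => jumpTime le ls lg x₀ (fun k c => ξ k c ω) m :=
  measurable_snd.comp ((measurable_jump x₀ m).comp
    (measurable_pi_lambda _ fun k => measurable_pi_lambda _ (hm k)))

/-- Many events are unlikely before a fixed time. -/
lemma mul_measure_jumpTime_lt_le (hle : 0 < le) (hls : 0 ≤ ls) (hlg : 0 ≤ lg)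
    (hm : ∀ m c, Measurable (ξ m c)) (hlaw : ∀ m c, P.map (ξ m c) = expMeasure 1)
    (hindep : iIndepFun (fun a : ℕ × Clock n => ξ a.1 a.2) P) (x₀ : NetState n) (m : ℕ)
    {T : ℝ} (hT : 0 ≤ T) :
    m * P.real {ω | jumpTime le ls lg x₀ (fun k c => ξ k c ω) m < ENNReal.ofReal T}
      ≤ (le + (ls + n * lg)) * T := by
  -- Weight `1` counts events, so their expected number is an integral of the total rate, at most
  -- `le + (ls + n * lg)`, over a time at most `T`. Markov's inequality does the rest.
  have key := fun k => integral_event hle hls hlg hm hlaw hindep x₀ k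
    (ENNReal.ofReal_ne_top (r := T)) (fun _ _ => 1) (K := 1) (fun _ _ => by simp)
  have hmeas := measurableSet_lt
    (measurable_jumpTime (le := le) (ls := ls) (lg := lg) hm x₀ m)
    (measurable_const (a := ENNReal.ofReal T))
  calc m * P.real {ω | jumpTime le ls lg x₀ (fun k c => ξ k c ω) m < ENNReal.ofReal T}
      = ∫ ω, {ω | jumpTime le ls lg x₀ (fun k c => ξ k c ω) m < ENNReal.ofReal T}.indicator
          (fun _ => (m : ℝ)) ω ∂P := by
        rw [integral_indicator_const _ hmeas, smul_eq_mul, mul_comm]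
    _ ≤ ∫ ω, ∑ k ∈ Finset.range m,
        (if jumpTime le ls lg x₀ (fun k c => ξ k c ω) (k + 1) < ENNReal.ofReal T then
          (1 : ℝ) else 0) ∂P := by
        refine integral_mono ((integrable_const _).indicator hmeas)
          (integrable_finsetSum _ fun k _ => (key k).1) fun ω => ?_
        refine Set.indicator_apply_le' (fun hω => ?_)
          fun _ => Finset.sum_nonneg fun k _ => by split_ifs <;> simp
        rw [Finset.sum_congr rfl fun k hk => if_pos ((monotone_jumpTime x₀ _
          (Nat.succ_le_of_lt (Finset.mem_range.1 hk))).trans_lt hω)]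
        simp
    _ = ∫ ω, ∑ k ∈ Finset.range m,
          (∑ c, (jumpChain le ls lg x₀ (fun k c => ξ k c ω) k).rate le ls lg c * 1) *
          holdingTime le ls lg x₀ (ENNReal.ofReal T) k (fun k c => ξ k c ω) ∂P := by
        rw [integral_finsetSum _ fun k _ => (key k).1,
          integral_finsetSum _ fun k _ => (key k).2.1]
        exact Finset.sum_congr rfl fun k _ => (key k).2.2
    _ ≤ ∫ _, (le + (ls + n * lg)) * T ∂P := by
        refine integral_mono (integrable_finsetSum _ fun k _ => (key k).2.1)
          (integrable_const _) fun ω => ?_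
        refine (Finset.sum_le_sum fun k _ => mul_le_mul_of_nonneg_right
          (by simpa using NetState.sum_rate_le (le := le) hls hlg _)
          (holdingTime_nonneg x₀ _ k _)).trans ?_
        rw [← Finset.mul_sum, sum_holdingTime x₀ ENNReal.ofReal_ne_top]
        exact mul_le_mul_of_nonneg_left (truncTime_mem x₀ hT m _).2 (by positivity)
    _ = (le + (ls + n * lg)) * T := by simp

/-- Dynkin's formula for `freshPotential`, stopped at the `m`-th event: the integrand is the
generator times the holding time, and its expectation is that of a telescoping sum bounded by `2 *
U`. -/
lemma abs_integral_sum_holdingTime_le (hle : 0 < le) (hls : 0 < ls) (hlg : 0 ≤ lg)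
    (hm : ∀ m c, Measurable (ξ m c)) (hlaw : ∀ m c, P.map (ξ m c) = expMeasure 1)
    (hindep : iIndepFun (fun a : ℕ × Clock n => ξ a.1 a.2) P) {x₀ : NetState n}
    (hx₀ : x₀.Valid) (i : Fin n) (m : ℕ) {U : ℝ}
    (hU : ∀ x, |NetState.freshPotential le ls lg i x| ≤ U) (T : ℝ) :
    Integrable (fun ω => ∑ k ∈ Finset.range m, (1 / n * NetState.refreshCount le ls lg n 0 -
      freshIndicator i (jumpChain le ls lg x₀ (fun k c => ξ k c ω) k)) *
          holdingTime le ls lg x₀ (ENNReal.ofReal T) k (fun k c => ξ k c ω)) P ∧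
    |∫ ω, ∑ k ∈ Finset.range m, (1 / n * NetState.refreshCount le ls lg n 0 -
      freshIndicator i (jumpChain le ls lg x₀ (fun k c => ξ k c ω) k)) *
          holdingTime le ls lg x₀ (ENNReal.ofReal T) k (fun k c => ξ k c ω) ∂P| ≤ 2 * U := by
  have hU2 : ∀ x y, |NetState.freshPotential le ls lg i x -
      NetState.freshPotential le ls lg i y| ≤ 2 * U := fun x y => by
    refine (abs_sub _ _).trans ?_
    linarith [hU x, hU y]
  have key := fun k => integral_event hle hls.le hlg hm hlaw hindep x₀ k
    (ENNReal.ofReal_ne_top (r := T)) (fun x c => NetState.freshPotential le ls lg i (x.apply c) -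
      NetState.freshPotential le ls lg i x) (K := 2 * U) (fun _ _ => hU2 _ _)
  have hgen : ∀ ω k, ∑ c, (jumpChain le ls lg x₀ (fun k c => ξ k c ω) k).rate le ls lg c *
      (NetState.freshPotential le ls lg i
        ((jumpChain le ls lg x₀ (fun k c => ξ k c ω) k).apply c) -
        NetState.freshPotential le ls lg i (jumpChain le ls lg x₀ (fun k c => ξ k c ω) k)) =
      1 / n * NetState.refreshCount le ls lg n 0 -
        freshIndicator i (jumpChain le ls lg x₀ (fun k c => ξ k c ω) k) := fun ω k =>
    NetState.generator_freshPotential hle hls hlg i (valid_jumpChain hx₀ _ k)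
  simp_rw [hgen] at key
  refine ⟨integrable_finsetSum _ fun k _ => (key k).2.1, ?_⟩
  rw [integral_finsetSum _ fun k _ => (key k).2.1, ← Finset.sum_congr rfl fun k _ => (key k).2.2,
    ← integral_finsetSum _ fun k _ => (key k).1]
  rw [← Real.norm_eq_abs]
  refine (norm_integral_le_of_norm_le_const (μ := P) (C := 2 * U)
    (ae_of_all _ fun ω => ?_)).trans_eq ?_
  · obtain ⟨l, hl⟩ := exists_sum_telescope (le := le) (ls := ls) (lg := lg) x₀
      (ENNReal.ofReal T) m (fun k c => ξ k c ω) fun k => NetState.freshPotential le ls lg i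
        (jumpChain le ls lg x₀ (fun k c => ξ k c ω) k)
    exact (congrArg norm hl).trans_le (hU2 _ _)
  · rw [probReal_univ, mul_one]

/-- The expected time that node `i` is fresh before `T` grows linearly, up to a bounded error. -/
theorem abs_integral_integral_freshness_sub_le (hle : 0 < le) (hls : 0 < ls) (hlg : 0 ≤ lg)
    (hm : ∀ m c, Measurable (ξ m c)) (hlaw : ∀ m c, P.map (ξ m c) = expMeasure 1)
    (hindep : iIndepFun (fun a : ℕ × Clock n => ξ a.1 a.2) P) {x₀ : NetState n}
    (hx₀ : x₀.Valid) (i : Fin n) {U : ℝ}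
    (hU : ∀ x, |NetState.freshPotential le ls lg i x| ≤ U) {T : ℝ} (hT : 0 ≤ T) :
    |(∫ ω, (∫ t in (0 : ℝ)..T, freshness le ls lg x₀ (fun m c => ξ m c ω) i t) ∂P) -
      1 / n * NetState.refreshCount le ls lg n 0 * T| ≤ 2 * U := by
  set a := 1 / n * NetState.refreshCount le ls lg n 0 with ha
  set Q := le + (ls + n * lg)
  have hint : Integrable
      (fun ω => ∫ t in (0 : ℝ)..T, freshness le ls lg x₀ (fun m c => ξ m c ω) i t) P := by
    simp_rw [intervalIntegral.integral_of_le hT]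
    exact (integrable_freshness hm x₀ i T).integral_prod_right
  have hsub : Integrable (fun ω =>
      (∫ t in (0 : ℝ)..T, freshness le ls lg x₀ (fun m c => ξ m c ω) i t) - a * T) P :=
    hint.sub (integrable_const _)
  -- The first error is the crude bound `(1 + |a|) * T` times the probability, at most `Q * T / m`,
  -- of `m` events before `T`; the second comes from Dynkin's formula. Only the right side depends
  -- on `m`.
  have hbound : ∀ m : ℕ, 0 < m →
      |(∫ ω, (∫ t in (0 : ℝ)..T, freshness le ls lg x₀ (fun m c => ξ m c ω) i t) ∂P) - a * T|
        ≤ (1 + |a|) * T * (Q * T) / m + 2 * U := by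
    intro m hmpos
    obtain ⟨hi, hle2⟩ := abs_integral_sum_holdingTime_le hle hls hlg hm hlaw hindep hx₀ i m hU T
    rw [← ha] at hi hle2
    have hmeas := measurableSet_lt
      (measurable_jumpTime (le := le) (ls := ls) (lg := lg) hm x₀ m)
      (measurable_const (a := ENNReal.ofReal T))
    have h1 := norm_integral_le_of_norm_le (μ := P)
      (f := fun ω => (∫ t in (0 : ℝ)..T, freshness le ls lg x₀ (fun m c => ξ m c ω) i t) - a * T +
        ∑ k ∈ Finset.range m, (a -
          freshIndicator i (jumpChain le ls lg x₀ (fun k c => ξ k c ω) k)) *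
            holdingTime le ls lg x₀ (ENNReal.ofReal T) k (fun k c => ξ k c ω))
      (((integrable_const ((1 + |a|) * T)).indicator hmeas)) (ae_of_all _ fun ω =>
        (abs_integral_freshness_sub_le (le := le) (ls := ls) (lg := lg) x₀ hT m
          (fun k c => ξ k c ω) i a).trans_eq
            (by simp only [Set.indicator_apply, Set.mem_ofPred_eq]))
    rw [integral_add hsub hi, integral_sub hint (integrable_const _),
      integral_const, probReal_univ, one_smul, integral_indicator_const _ hmeas, smul_eq_mul] at h1
    have h2 := mul_measure_jumpTime_lt_le hle hls.le hlg hm hlaw hindep x₀ m hT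
    rw [mul_comm, ← le_div_iff₀ (by exact_mod_cast hmpos)] at h2
    have h3 := mul_le_mul_of_nonneg_right h2 (by positivity : 0 ≤ (1 + |a|) * T)
    have h4 := abs_sub_abs_le_abs_sub
      ((∫ ω, (∫ t in (0 : ℝ)..T, freshness le ls lg x₀ (fun m c => ξ m c ω) i t) ∂P) - a * T)
      (-∫ ω, ∑ k ∈ Finset.range m, (a -
        freshIndicator i (jumpChain le ls lg x₀ (fun k c => ξ k c ω) k)) *
          holdingTime le ls lg x₀ (ENNReal.ofReal T) k (fun k c => ξ k c ω) ∂P)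
    rw [sub_neg_eq_add, abs_neg] at h4
    have h5 : Q * T / m * ((1 + |a|) * T) = (1 + |a|) * T * (Q * T) / m := by ring
    rw [← h5]
    have h6 := h4.trans (h1.trans h3)
    linarith
  have hlim : Tendsto (fun m : ℕ => (1 + |a|) * T * (Q * T) / m + 2 * U) atTop
      (𝓝 (0 + 2 * U)) :=
    (tendsto_const_div_atTop_nhds_zero_nat _).add tendsto_const_nhds
  rw [zero_add] at hlim
  exact ge_of_tendsto hlim ((eventually_gt_atTop 0).mono hbound)

theorem tendsto_average_freshness (hle : 0 < le) (hls : 0 < ls) (hlg : 0 ≤ lg)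
    (hm : ∀ m c, Measurable (ξ m c)) (hlaw : ∀ m c, P.map (ξ m c) = expMeasure 1)
    (hindep : iIndepFun (fun a : ℕ × Clock n => ξ a.1 a.2) P) {x₀ : NetState n}
    (hx₀ : x₀.Valid) (i : Fin n) :
    Tendsto (fun T : ℝ => (1 / T) *
      ∫ ω, (∫ t in (0 : ℝ)..T, freshness le ls lg x₀ (fun m c => ξ m c ω) i t) ∂P) atTop
      (𝓝 (1 / n * NetState.refreshCount le ls lg n 0)) := by
  obtain ⟨U, hU⟩ := NetState.exists_abs_freshPotential_le le ls lg i
  rw [tendsto_iff_norm_sub_tendsto_zero]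
  refine squeeze_zero' (Eventually.of_forall fun _ => norm_nonneg _) ?_
    ((tendsto_const_nhds (x := 2 * U)).div_atTop tendsto_id)
  filter_upwards [eventually_gt_atTop 0] with T hT
  have h := abs_integral_integral_freshness_sub_le hle hls hlg hm hlaw hindep hx₀ i hU hT.le
  refine (le_div_iff₀ hT).2 ((congrArg₂ (· * ·) rfl (abs_of_pos hT).symm).trans_le ?_)
  have hmul : ∀ I A : ℝ, (1 / T * I - A) * T = I - A * T := fun I A => by field_simp
  rwa [Real.norm_eq_abs, ← abs_mul, hmul]

end Probability

end RCGossip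

end

theorem mainTheorem1 {Ω : Type*} [MeasurableSpace Ω] (P : Measure Ω) [IsProbabilityMeasure P]
    (n : ℕ) (le ls lg : ℝ) (hle : 0 < le) (hls : 0 < ls) (hlg : 0 ≤ lg)
    (x₀ : NetState n) (hx₀ : ∀ i, x₀.node i ≤ x₀.src)
    (ξ : ℕ → Clock n → Ω → ℝ)
    (hlaw : ∀ m c, HasLaw (ξ m c) (expMeasure 1) P)
    (hindep : iIndepFun (fun a : ℕ × Clock n => ξ a.1 a.2) P)
    (i : Fin n) :
    (∀ T : ℝ, Integrable
      (fun q : ℝ × Ω => RCGossip.freshness le ls lg x₀ (fun m c => ξ m c q.2) i q.1)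
      ((volume.restrict (Set.Ioc 0 T)).prod P)) ∧
    RCGossip.averageFreshness P le ls lg x₀ ξ i =
      (1 / (n : ℝ)) * ∑ k ∈ Finset.Icc 1 n, ∏ j ∈ Finset.Icc 1 k,
        (ls + ((j : ℝ) - 1) * lg) / (ls + ((j : ℝ) - 1) * lg + le) := by
  -- `HasLaw` gives only almost everywhere measurability, so the clocks are replaced by measurable
  -- versions; there are countably many, hence all agree at once almost surely.
  have hm : ∀ m c, Measurable ((hlaw m c).aemeasurable.mk) := fun m c =>
    (hlaw m c).aemeasurable.measurable_mk
  have hξ : ∀ m c, ξ m c =ᵐ[P] (hlaw m c).aemeasurable.mk := fun m c =>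
    (hlaw m c).aemeasurable.ae_eq_mk
  have hlaw' : ∀ m c, P.map ((hlaw m c).aemeasurable.mk) = expMeasure 1 := fun m c => by
    rw [← Measure.map_congr (hξ m c), (hlaw m c).map_eq]
  have hindep' := hindep.congr fun a : ℕ × Clock n => hξ a.1 a.2
  have hae : ∀ᵐ ω ∂P, (fun m c => (hlaw m c).aemeasurable.mk (ξ m c) ω) = fun m c => ξ m c ω := by
    have h : ∀ᵐ ω ∂P, ∀ m c, ξ m c ω = (hlaw m c).aemeasurable.mk (ξ m c) ω :=
      ae_all_iff.2 fun m => ae_all_iff.2 fun c => hξ m c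
    filter_upwards [h] with ω hω
    ext m c
    exact (hω m c).symm
  refine ⟨fun T => ?_, ?_⟩
  · refine (RCGossip.integrable_freshness (le := le) (ls := ls) (lg := lg) hm x₀ i T).congr ?_
    filter_upwards [Measure.quasiMeasurePreserving_snd.ae hae] with q hq
    rw [hq]
  · rw [RCGossip.averageFreshness, ← NetState.refreshCount_zero]
    refine Tendsto.limsup_eq
      ((RCGossip.tendsto_average_freshness hle hls hlg hm hlaw' hindep' hx₀ i).congr fun T => ?_)
    congr 1
    refine integral_congr_ae ?_
    filter_upwards [hae] with ω hω
    rw [hω]
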